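/- \textbf{Definitions.} Let $(X,\mu)$ be a probability space and $T:X\to X$ an invertible bimeasurable $\mu$-preserving transformation. Given an integer $h_1\ge 0$, a sequence of cut numbers $r_j\ge 1$ and spacer numbers $s_j(i)\ge 0$ ($j\ge 1$, $1\le i\le r_j$), define $h_j$ by $$h_{j+1}+1=(h_j+1)r_j+\sum_{i=1}^{r_j}s_j(i).$$ $T$ is a \emph{rank-one construction} with these parameters if there are measurable sets $E_j$ and $E_j^i$ ($1\le i\le r_j$) such that, for all $j$: the levels $E_j,TE_j,\dots,T^{h_j}E_j$ of the $j$-th tower are pairwise disjoint; $E_j=E_j^1\sqcup\dots\sqcup E_j^{r_j}$ with $\mu(E_j^1)=\dots=\mu(E_j^{r_j})$; $T^{h_j+1+s_j(i)}E_j^i=E_j^{i+1}$ for $1\le i<r_j$; $E_{j+1}=E_j^1$; and if, for every measurable $A$ and every $\varepsilon>0$, for all sufficiently large $j$ there is a union $A'$ of levels of the $j$-th tower with $\mu(A\,\triangle\,A')<\varepsilon$. The construction is \emph{bounded} if $r_j\ge 2$ for all $j$ and there are $r,s$ with $r_j<r$ and $s_j(i)<s$ for all $j$ and all $1\le i\le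 r_j$. $T$ is \emph{rigid} if there is a sequence of integers $m_j\to+\infty$ with $\mu(T^{m_j}A\,\triangle\,A)\to0$ for every measurable $A$, and \emph{totally ergodic} if $T^i$ is ergodic for every integer $i\ne0$. A \emph{self-joining} (of order 2) of $T$ is a $T\times T$-invariant measure $\nu$ on $X\times X$ both of whose marginals are $\mu$; it is \emph{ergodic} if $(T\times T,X\times X,\nu)$ is ergodic. For $i\in\mathbb Z$ the measure $\Delta^i$ on $X\times X$ is given by $\Delta^i(A\times B)=\mu(A\cap T^iB)$. $T$ has \emph{minimal self-joinings} (of order 2) if it has no ergodic self-joinings except $\mu\times\mu$ and $\Delta^i$, $i\in\mathbb Z$. \textbf{Theorem.} Let $T$ be a bounded rank-one construction that is non-rigid and totally ergodic. Then $T$ has minimal self-joinings: every ergodic self-joining $\nu$ of order 2 of $T$ equals $\mu\times\mu$ or $\Delta^i$ for some $i\in\mathbb Z$. -/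

import Mathlib

open MeasureTheory Filter Topology
open scoped ENNReal symmDiff

namespace RankOne

/-- The number of levels of the `j`-th tower (`h_j + 1` when the levels are numbered `0, …, h_j`),
for the initial integer `h₁`, the cut sequence `r` and the spacer sequence `s`.
Steps are numbered from `0`, and the columns of the `j`-th tower are numbered `0, …, r j - 1`, so
`s j i` is the number of spacers put over the column number `i` at the step `j`. -/
def towerHeight (h₁ : ℕ) (r : ℕ → ℕ) (s : ℕ → ℕ → ℕ) : ℕ → ℕ
  | 0 => h₁ + 1
  | j + 1 => towerHeight h₁ r s j * r j + ∑ i ∈ Finset.range (r j), s j i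

variable {X : Type*} [MeasurableSpace X]

/-- `T` acts on the sets `E j` (bases of the towers) and `C j i` (base of the `i`-th column of the
`j`-th tower) as prescribed by the cutting-and-stacking procedure with parameters `h₁`, `r`, `s`. -/
structure IsCuttingAndStacking (μ : Measure X) (T : X → X) (h₁ : ℕ) (r : ℕ → ℕ) (s : ℕ → ℕ → ℕ)
    (E : ℕ → Set X) (C : ℕ → ℕ → Set X) : Prop where
  measurableSet_base : ∀ j, MeasurableSet (E j)
  measurableSet_column : ∀ j, ∀ i < r j, MeasurableSet (C j i)
  /-- The levels `E j, T (E j), T² (E j), …` of the `j`-th tower are pairwise disjoint. -/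
  disjoint_levels : ∀ j, Set.PairwiseDisjoint {k : ℕ | k < towerHeight h₁ r s j}
    (fun k => T^[k] '' E j)
  /-- `E j` is cut into the `r j` sets `C j 0, …, C j (r j - 1)` … -/
  base_eq_iUnion : ∀ j, E j = ⋃ i ∈ Finset.range (r j), C j i
  disjoint_columns : ∀ j, Set.PairwiseDisjoint {i : ℕ | i < r j} (C j)
  /-- … of the same measure. -/
  measure_column : ∀ j, ∀ i < r j, ∀ i' < r j, μ (C j i) = μ (C j i')
  /-- The `i`-th column, with `s j i` spacers added over it, is followed by the next column. -/
  stack : ∀ j i, i + 1 < r j → T^[towerHeight h₁ r s j + s j i] '' C j i = C j (i + 1)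
  /-- The base of the next tower is the base of the first column. -/
  base_succ : ∀ j, E (j + 1) = C j 0
  /-- The towers exhaust the space and their levels approximate every measurable set. -/
  approx : ∀ A, MeasurableSet A → ∀ ε : ℝ≥0∞, 0 < ε → ∃ J, ∀ j ≥ J,
    ∃ S : Finset ℕ, (∀ k ∈ S, k < towerHeight h₁ r s j) ∧ μ (A ∆ ⋃ k ∈ S, T^[k] '' E j) < ε

/-- `T` is a rank-one construction with parameters `h₁`, `r`, `s`. -/
def IsRankOneConstruction (μ : Measure X) (T : X → X) (h₁ : ℕ) (r : ℕ → ℕ) (s : ℕ → ℕ → ℕ) :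
    Prop :=
  ∃ (E : ℕ → Set X) (C : ℕ → ℕ → Set X), IsCuttingAndStacking μ T h₁ r s E C

/-- The cut numbers (at least `2`) and the spacer numbers are uniformly bounded. -/
def IsBoundedParameters (r : ℕ → ℕ) (s : ℕ → ℕ → ℕ) : Prop :=
  (∀ j, 2 ≤ r j) ∧ (∃ R, ∀ j, r j < R) ∧ ∃ S, ∀ j, ∀ i < r j, s j i < S

/-- The integer power `T ^ i` of an automorphism. -/
def power (T : X ≃ᵐ X) (i : ℤ) : X → X := ⇑((T.toEquiv : Equiv.Perm X) ^ i)

theorem measurable_power (T : X ≃ᵐ X) (i : ℤ) : Measurable (power T i) := by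
  have key : ∀ (f : Equiv.Perm X), Measurable f → ∀ n : ℕ, Measurable ⇑(f ^ n) := by
    intro f hf n
    induction n with
    | zero => simpa using measurable_id
    | succ n ih =>
      rw [pow_succ, Equiv.Perm.coe_mul]
      exact ih.comp hf
  unfold power
  cases i with
  | ofNat n =>
    simpa using key T.toEquiv T.measurable n
  | negSucc n =>
    rw [zpow_negSucc, ← inv_pow]
    exact key _ T.symm.measurable (n + 1)

/-- `T` is rigid: `T ^ (m j) → Id` along some sequence `m j → ∞`, that is,
`μ (T ^ (m j) A ∆ A) → 0` for every measurable `A`. -/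
def IsRigid (μ : Measure X) (T : X ≃ᵐ X) : Prop :=
  ∃ m : ℕ → ℕ, Tendsto m atTop atTop ∧
    ∀ A, MeasurableSet A → Tendsto (fun j => μ ((T^[m j] '' A) ∆ A)) atTop (𝓝 0)

/-- All non-zero powers of `T` are ergodic. -/
def IsTotallyErgodic (μ : Measure X) (T : X ≃ᵐ X) : Prop :=
  ∀ i : ℤ, i ≠ 0 → Ergodic (power T i) μ

/-- `ν` is a self-joining (of order 2) of `(T, μ)`. -/
structure IsSelfJoining (μ : Measure X) (T : X → X) (ν : Measure (X × X)) : Prop where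
  map_fst : ν.map Prod.fst = μ
  map_snd : ν.map Prod.snd = μ
  invariant : MeasurePreserving (Prod.map T T) ν ν

/-- The off-diagonal measure `Δ^i`, with `Δ^i (A × B) = μ (A ∩ T^i B)`. -/
noncomputable def offDiagonal (μ : Measure X) (T : X ≃ᵐ X) (i : ℤ) : Measure (X × X) :=
  μ.map (fun x => (x, power T (-i) x))

theorem offDiagonal_prod (μ : Measure X) (T : X ≃ᵐ X) (i : ℤ) {A B : Set X}
    (hA : MeasurableSet A) (hB : MeasurableSet B) :
    offDiagonal μ T i (A ×ˢ B) = μ (A ∩ power T i '' B) := by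
  have h : power T i '' B = power T (-i) ⁻¹' B := by
    unfold power
    rw [zpow_neg]
    exact Equiv.image_eq_preimage_symm _ B
  have hm : Measurable (fun x => (x, power T (-i) x)) :=
    measurable_id.prodMk (measurable_power T (-i))
  rw [offDiagonal, Measure.map_apply hm (hA.prod hB), h]
  rfl

/-- `T` has minimal self-joinings of order 2: it has no ergodic self-joinings except the product
measure and the off-diagonal measures. -/
def HasMinimalSelfJoinings (μ : Measure X) (T : X ≃ᵐ X) : Prop :=
  ∀ ν : Measure (X × X), IsSelfJoining μ T ν → Ergodic (Prod.map T T) ν →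
    ν = μ.prod μ ∨ ∃ i : ℤ, ν = offDiagonal μ T i

end RankOne

/-!
A point `x` determines, for each `j`, the set of the times at which its orbit enters the base of the
`j`-th tower; the intervals of length `towerHeight h₁ r s j` that start at these times are the
`j`-blocks of `x`. The blocks of all levels form a hierarchy (`IsHierarchy`): every block of a level
is cut in the same way into blocks of the lower levels and spacers. Let `ν` be an ergodic
self-joining, and consider the hierarchies of the coordinates of a `ν`-generic pair `(x, y)`.

*Offsets do not drift unless `ν` is the product* (`IsSelfJoining.ae_eventually_noDrift`). Suppose
that for infinitely many `j` there are, at a distance comparable with the height of the tower, two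
pairs of overlapping `j`-blocks of `x` and `y` with long overlaps and with offsets that differ by a
bounded nonzero integer, which may be taken to be a constant `e`. The overlaps look alike, except
that the blocks of `y` are displaced by `e`. By Birkhoff's theorem along intervals
(`ae_abs_interval_sum_sub_le`) the joining `ν` is then invariant under the action of a
nontrivial power of `T` on the second coordinate. That power is ergodic, so `ν = μ × μ`.

*Non-rigidity gives unequal gaps* (`IsCuttingAndStacking.exists_isUnequalGap`). If for every `m`
there were arbitrarily large `j` such that all the gaps between consecutive `j`-blocks in a
`(j + m)`-block are equal, then the translations by one block would be powers of `T` that converge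
to the identity.

*Without drift, the hierarchies are translates of each other.* With a probability that is bounded
below, `0` is in a `j`-block of `x` that is followed by unequal gaps and is far from the ends of a
`(j + k)`-block of `y`, inside which the gaps are bounded
(`IsSelfJoining.exists_le_measureReal_central`). At such a time the two hierarchies are aligned with
an offset `d` much smaller than the height of the `j`-th tower: otherwise, all the overlaps around
`0` would be long, and the absence of drift would make all the gaps equal
(`IsCentral.exists_alignedAt`). Since aligned blocks have the same internal structure, the same
`d` is the offset of blocks of every lower level `l`, and the same argument shows that `d` is small
in comparison with the height of the `l`-th tower (`AlignedAt.mul_abs_le`). Descending to a fixed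
level bounds `d`. Hence one `d` serves for infinitely many `j`, and as the blocks around `0` exhaust
the integers, the whole hierarchies differ by the translation by `d`. By ergodicity this `d` is the
same for almost all pairs, and `ν` is carried by the graph of `T ^ d`
(`IsSelfJoining.eq_offDiagonal`).

Spacers over the last columns may accumulate, so that the gaps between blocks are not bounded.
For this reason drift is excluded only for bounded differences of offsets, and gaps are considered
only inside blocks of a level that is higher by a constant.
-/

namespace RankOne

/-! ### Birkhoff's theorem -/

section Birkhoff

variable {Ω : Type*}

/-- The maximum of the Birkhoff sums of `g` of lengths `1, …, n + 1`. -/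
noncomputable def maxBirkhoffSum (f : Ω → Ω) (g : Ω → ℝ) : ℕ → Ω → ℝ
  | 0 => g
  | n + 1 => fun z => g z + max 0 (maxBirkhoffSum f g n (f z))

theorem maxBirkhoffSum_le_succ (f : Ω → Ω) (g : Ω → ℝ) (n : ℕ) (z : Ω) :
    maxBirkhoffSum f g n z ≤ maxBirkhoffSum f g (n + 1) z := by
  induction n generalizing z with
  | zero => simp [maxBirkhoffSum]
  | succ n ih =>
    have := ih (f z)
    simp only [maxBirkhoffSum] at this ⊢
    gcongr

theorem birkhoffSum_le_maxBirkhoffSum (f : Ω → Ω) (g : Ω → ℝ) (n : ℕ) (z : Ω) :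
    birkhoffSum f g (n + 1) z ≤ maxBirkhoffSum f g n z := by
  induction n generalizing z with
  | zero => simp [maxBirkhoffSum]
  | succ n ih =>
    rw [birkhoffSum_succ']
    simp only [maxBirkhoffSum]
    gcongr
    exact (ih (f z)).trans (le_max_right _ _)

variable [MeasurableSpace Ω] {ν : Measure Ω}

theorem measurable_maxBirkhoffSum {f : Ω → Ω} (hf : Measurable f) {g : Ω → ℝ} (hg : Measurable g)
    (n : ℕ) : Measurable (maxBirkhoffSum f g n) := by
  induction n with
  | zero => exact hg
  | succ n ih => exact hg.add (measurable_const.max (ih.comp hf))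

theorem integrable_maxBirkhoffSum {f : Ω → Ω} (hf : MeasurePreserving f ν ν) {g : Ω → ℝ}
    (hg : Integrable g ν) (n : ℕ) : Integrable (maxBirkhoffSum f g n) ν := by
  induction n with
  | zero => exact hg
  | succ n ih =>
    exact hg.add ((integrable_zero Ω ℝ ν).sup (hf.integrable_comp_of_integrable ih))

/-- If the Birkhoff sums of `g` were unbounded above almost everywhere, then
`maxBirkhoffSum (n + 1) - maxBirkhoffSum n ∘ f`, which has a nonnegative integral, would decrease
to `g`, so that `∫ g` could not be negative. By ergodicity, they are bounded above almost
everywhere when `∫ g < 0`. -/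
theorem ae_bddAbove_birkhoffSum {f : Ω → Ω} (hf : Ergodic f ν) {g : Ω → ℝ} (hgm : Measurable g)
    (hg : Integrable g ν) (hneg : ∫ z, g z ∂ν < 0) :
    ∀ᵐ z ∂ν, BddAbove (Set.range fun n => birkhoffSum f g n z) := by
  have hmp := hf.toMeasurePreserving
  have hSm : ∀ n, Measurable (birkhoffSum f g n) := fun n => by
    have : birkhoffSum f g n = fun z => ∑ k ∈ Finset.range n, g (f^[k] z) := rfl
    rw [this]
    exact Finset.measurable_fun_sum _ fun k _ => hgm.comp (hf.measurable.iterate k)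
  have hEm : MeasurableSet {z | BddAbove (Set.range fun n => birkhoffSum f g n z)} :=
    measurableSet_bddAbove_range hSm
  have hEinv : f ⁻¹' {z | BddAbove (Set.range fun n => birkhoffSum f g n z)} =
      {z | BddAbove (Set.range fun n => birkhoffSum f g n z)} := by
    ext z
    simp only [Set.mem_preimage, Set.mem_ofPred_eq, bddAbove_def, Set.forall_mem_range]
    constructor
    · rintro ⟨c, hc⟩
      refine ⟨max 0 (g z + c), fun n => ?_⟩
      cases n with
      | zero => simp
      | succ n =>
        rw [birkhoffSum_succ']
        exact le_trans (by linarith [hc n]) (le_max_right _ _)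
    · rintro ⟨c, hc⟩
      refine ⟨c - g z, fun n => ?_⟩
      have := hc (n + 1)
      rw [birkhoffSum_succ'] at this
      linarith
  rcases hf.toPreErgodic.ae_mem_or_ae_notMem hEm hEinv with h | h
  · exact h
  exfalso
  have hmono : ∀ z, Monotone fun n => maxBirkhoffSum f g n z := fun z =>
    monotone_nat_of_le_succ fun n => maxBirkhoffSum_le_succ f g n z
  have htop : ∀ᵐ z ∂ν, Tendsto (fun n => maxBirkhoffSum f g n z) atTop atTop := by
    filter_upwards [h] with z hz
    refine tendsto_atTop_atTop_of_monotone (hmono z) fun b => ?_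
    simp only [bddAbove_def, Set.forall_mem_range, not_exists, not_forall, not_le] at hz
    obtain ⟨n, hn⟩ := hz (max 0 b)
    cases n with
    | zero => simp at hn
    | succ n =>
      exact ⟨n, ((le_max_right 0 b).trans hn.le).trans (birkhoffSum_le_maxBirkhoffSum f g n z)⟩
  have hlim : Tendsto (fun n => ∫ z, (maxBirkhoffSum f g (n + 1) z - maxBirkhoffSum f g n (f z)) ∂ν)
      atTop (𝓝 (∫ z, g z ∂ν)) := by
    refine tendsto_integral_of_dominated_convergence (fun z => |g z| + |g (f z)|) (fun n => ?_)
      (hg.abs.add (hmp.integrable_comp_of_integrable hg.abs)) (fun n => ?_) ?_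
    · exact ((measurable_maxBirkhoffSum hf.measurable hgm _).sub
        ((measurable_maxBirkhoffSum hf.measurable hgm _).comp hf.measurable)).aestronglyMeasurable
    · refine Eventually.of_forall fun z => ?_
      have h0 : g (f z) ≤ maxBirkhoffSum f g n (f z) := hmono (f z) (Nat.zero_le n)
      simp only [maxBirkhoffSum, Real.norm_eq_abs]
      rw [abs_le]
      rcases le_total 0 (maxBirkhoffSum f g n (f z)) with h' | h'
      · rw [max_eq_right h']
        constructor <;> linarith [neg_abs_le (g z), le_abs_self (g z), abs_nonneg (g (f z))]
      · rw [max_eq_left h']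
        constructor <;> linarith [neg_abs_le (g z), le_abs_self (g z), neg_abs_le (g (f z)),
          abs_nonneg (g (f z))]
    · filter_upwards [hmp.quasiMeasurePreserving.ae htop] with z hz
      refine tendsto_const_nhds.congr' ?_
      filter_upwards [hz.eventually_ge_atTop 0] with n hn
      simp [maxBirkhoffSum, max_eq_right hn]
  refine absurd (ge_of_tendsto' hlim fun n => ?_) (not_le.mpr hneg)
  have hI := fun n => integrable_maxBirkhoffSum hmp hg n
  have hI' : Integrable (fun z => maxBirkhoffSum f g n (f z)) ν :=
    hmp.integrable_comp_of_integrable (hI n)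
  rw [integral_sub (hI _) hI']
  have hc : ∫ z, maxBirkhoffSum f g n (f z) ∂ν = ∫ z, maxBirkhoffSum f g n z ∂ν := by
    conv_rhs => rw [← hmp.map_eq]
    rw [integral_map hf.measurable.aemeasurable]
    exact (measurable_maxBirkhoffSum hf.measurable hgm _).aestronglyMeasurable
  rw [hc, sub_nonneg]
  exact integral_mono (hI _) (hI _) fun z => hmono z n.le_succ

/-- Birkhoff's pointwise ergodic theorem for an ergodic transformation. -/
theorem ae_abs_birkhoffSum_sub_le [IsProbabilityMeasure ν] {f : Ω → Ω} (hf : Ergodic f ν)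
    {g : Ω → ℝ} (hgm : Measurable g) (hg : Integrable g ν) :
    ∀ᵐ z ∂ν, ∀ ε > 0, ∃ c, ∀ n : ℕ, |birkhoffSum f g n z - n * ∫ z, g z ∂ν| ≤ ε * n + c := by
  have key : ∀ g : Ω → ℝ, Measurable g → Integrable g ν → ∀ ε > 0, ∀ᵐ z ∂ν, ∃ c, ∀ n : ℕ,
      birkhoffSum f g n z - n * ∫ z, g z ∂ν ≤ ε * n + c := by
    intro g hgm hg ε hε
    have hneg : ∫ z, (g z - (∫ z, g z ∂ν + ε)) ∂ν < 0 := by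
      rw [integral_sub hg (integrable_const _), integral_const]
      simp [hε]
    filter_upwards [ae_bddAbove_birkhoffSum hf (hgm.sub_const _) (hg.sub (integrable_const _))
      hneg] with z ⟨c, hc⟩
    refine ⟨c, fun n => ?_⟩
    have := hc ⟨n, rfl⟩
    simp only [birkhoffSum, Finset.sum_sub_distrib, Finset.sum_const, Finset.card_range,
      nsmul_eq_mul] at this ⊢
    linarith
  have hall : ∀ᵐ z ∂ν, ∀ k : ℕ, ∃ c, ∀ n : ℕ,
      |birkhoffSum f g n z - n * ∫ z, g z ∂ν| ≤ 1 / ((k : ℝ) + 1) * n + c := by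
    rw [ae_all_iff]
    intro k
    have hk : (0 : ℝ) < 1 / ((k : ℝ) + 1) := by positivity
    filter_upwards [key g hgm hg _ hk, key (fun z => -g z) hgm.neg hg.neg _ hk]
      with z ⟨c, hc⟩ ⟨c', hc'⟩
    refine ⟨max c c', fun n => abs_le.mpr ⟨?_, ?_⟩⟩
    · have := hc' n
      simp only [birkhoffSum, Finset.sum_neg_distrib, integral_neg] at this ⊢
      linarith [le_max_right c c']
    · linarith [hc n, le_max_left c c']
  filter_upwards [hall] with z hz ε hε
  obtain ⟨k, hk⟩ := exists_nat_one_div_lt hε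
  obtain ⟨c, hc⟩ := hz k
  refine ⟨c, fun n => (hc n).trans ?_⟩
  gcongr

theorem power_zero (T : Ω ≃ᵐ Ω) (x : Ω) : power T 0 x = x := by simp [power]

theorem power_add (T : Ω ≃ᵐ Ω) (a b : ℤ) (x : Ω) :
    power T (a + b) x = power T a (power T b x) := by
  simp [power, zpow_add]

theorem power_one (T : Ω ≃ᵐ Ω) (x : Ω) : power T 1 x = T x := by simp [power]

theorem power_natCast (T : Ω ≃ᵐ Ω) (n : ℕ) (x : Ω) : power T n x = T^[n] x := by
  simp only [power, zpow_natCast, ← Equiv.Perm.iterate_eq_pow]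
  rfl

theorem power_neg_natCast (T : Ω ≃ᵐ Ω) (n : ℕ) (x : Ω) : power T (-n) x = T.symm^[n] x := by
  simp only [power, zpow_neg, zpow_natCast, ← inv_pow, ← Equiv.Perm.iterate_eq_pow]
  rfl

theorem ergodic_symm {T : Ω ≃ᵐ Ω} (hT : Ergodic T ν) : Ergodic T.symm ν where
  toMeasurePreserving := hT.toMeasurePreserving.symm T
  aeconst_set s hs h := by
    refine hT.aeconst_set hs ?_
    conv_lhs => rw [← h]
    rw [← Set.preimage_comp, T.symm_comp_self, Set.preimage_id]

/-- The two-sided form of Birkhoff's theorem: averages over long intervals of integers that are not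
too far from `0`, relative to their lengths, are close to the integral. -/
theorem ae_abs_interval_sum_sub_le [IsProbabilityMeasure ν] {T : Ω ≃ᵐ Ω} (hT : Ergodic T ν)
    {g : Ω → ℝ} (hgm : Measurable g) (hg : Integrable g ν) :
    ∀ᵐ z ∂ν, ∀ ε > 0, ∃ c : ℝ, ∀ (a : ℤ) (n : ℕ),
      |∑ k ∈ Finset.range n, g (power T (a + k) z) - n * ∫ z, g z ∂ν| ≤
        ε * (|(a : ℝ)| + |((a + n : ℤ) : ℝ)|) + c := by
  have hS := ergodic_symm hT
  have h1 := ae_abs_birkhoffSum_sub_le hT hgm hg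
  have h2 := hS.toMeasurePreserving.quasiMeasurePreserving.ae
    (ae_abs_birkhoffSum_sub_le hS hgm hg)
  filter_upwards [h1, h2] with z hz hz' ε hε
  obtain ⟨c, hc⟩ := hz ε hε
  obtain ⟨c', hc'⟩ := hz' ε hε
  -- a primitive of the sequence of values along the orbit
  let F : ℤ → ℝ := fun n => match n with
    | .ofNat n => birkhoffSum T g n z
    | .negSucc n => - birkhoffSum T.symm g (n + 1) (T.symm z)
  have hFs : ∀ n : ℤ, F (n + 1) = F n + g (power T n z) := by
    intro n
    rcases n with n | n
    · change birkhoffSum T g (n + 1) z = birkhoffSum T g n z + g (power T (n : ℤ) z)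
      rw [birkhoffSum_succ, power_natCast]
    · have hp : power T (Int.negSucc n) z = T.symm^[n] (T.symm z) := by
        rw [Int.negSucc_eq, ← Nat.cast_succ, power_neg_natCast, Function.iterate_succ_apply]
      cases n with
      | zero =>
        change birkhoffSum T g 0 z = - birkhoffSum T.symm g 1 (T.symm z) + _
        rw [hp]
        simp
      | succ n =>
        change - birkhoffSum T.symm g (n + 1) (T.symm z) =
          - birkhoffSum T.symm g (n + 1 + 1) (T.symm z) + _
        rw [hp, birkhoffSum_succ _ _ (n + 1)]
        ring
  have hFb : ∀ n : ℤ, |F n - n * ∫ z, g z ∂ν| ≤ ε * |(n : ℝ)| + max c c' := by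
    intro n
    rcases n with n | n
    · have h := hc n
      change |birkhoffSum T g n z - ((n : ℤ) : ℝ) * _| ≤ ε * |((n : ℤ) : ℝ)| + _
      rw [Int.cast_natCast, Nat.abs_cast]
      linarith [le_max_left c c']
    · have h := hc' (n + 1)
      change |- birkhoffSum T.symm g (n + 1) (T.symm z) - _| ≤ _
      have e : ((Int.negSucc n : ℤ) : ℝ) = - ((n + 1 : ℕ) : ℝ) := by simp [Int.negSucc_eq]
      rw [e, abs_neg, Nat.abs_cast, neg_mul, ← neg_sub', abs_neg]
      linarith [le_max_right c c']
  have hsum : ∀ (a : ℤ) (n : ℕ), ∑ k ∈ Finset.range n, g (power T (a + k) z) =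
      F (a + n) - F a := by
    intro a n
    induction n with
    | zero => simp
    | succ n ih =>
      rw [Finset.sum_range_succ, ih, Nat.cast_succ, ← add_assoc, hFs]
      ring
  refine ⟨2 * max c c', fun a n => ?_⟩
  rw [hsum]
  have h1 := hFb a
  have h2 := hFb (a + n)
  calc _ = |(F (a + n) - ((a + n : ℤ) : ℝ) * ∫ z, g z ∂ν) - (F a - a * ∫ z, g z ∂ν)| := by
        congr 1; push_cast; ring
    _ ≤ _ := (abs_sub _ _).trans (by linarith)

end Birkhoff

/-! ### Heights of the towers and positions of the blocks -/

section Blocks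

variable {h₁ : ℕ} {r : ℕ → ℕ} {s : ℕ → ℕ → ℕ}

local notation "H" => towerHeight h₁ r s

theorem towerHeight_succ (j : ℕ) : H (j + 1) = H j * r j + ∑ i ∈ Finset.range (r j), s j i := rfl

theorem two_mul_towerHeight_le (hr : ∀ j, 2 ≤ r j) (j : ℕ) : 2 * H j ≤ H (j + 1) := by
  rw [towerHeight_succ, mul_comm]
  exact (Nat.mul_le_mul_left _ (hr j)).trans (Nat.le_add_right _ _)

theorem two_pow_mul_towerHeight_le (hr : ∀ j, 2 ≤ r j) (j m : ℕ) : 2 ^ m * H j ≤ H (j + m) := by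
  induction m with
  | zero => simp
  | succ m ih =>
    calc 2 ^ (m + 1) * H j = 2 * (2 ^ m * H j) := by ring
      _ ≤ 2 * H (j + m) := by gcongr
      _ ≤ _ := two_mul_towerHeight_le hr (j + m)

theorem two_pow_le_towerHeight (hr : ∀ j, 2 ≤ r j) (j : ℕ) : 2 ^ j ≤ H j := by
  have h := two_pow_mul_towerHeight_le (h₁ := h₁) (s := s) hr 0 j
  rw [zero_add] at h
  exact (Nat.le_mul_of_pos_right _ (Nat.succ_pos _)).trans h

theorem towerHeight_pos (hr : ∀ j, 2 ≤ r j) (j : ℕ) : 0 < H j :=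
  (pow_pos two_pos j).trans_le (two_pow_le_towerHeight hr j)

theorem tendsto_towerHeight (hr : ∀ j, 2 ≤ r j) : Tendsto H atTop atTop :=
  tendsto_atTop_mono (two_pow_le_towerHeight hr) (tendsto_pow_atTop_atTop_of_one_lt one_lt_two)

theorem towerHeight_mono (hr : ∀ j, 2 ≤ r j) : Monotone H :=
  monotone_nat_of_le_succ fun j => by have := two_mul_towerHeight_le (h₁ := h₁) (s := s) hr j; omega

theorem towerHeight_succ_le (hr : ∀ j, 2 ≤ r j) {R S : ℕ} (hR : ∀ j, r j ≤ R)
    (hS : ∀ j, ∀ i < r j, s j i ≤ S) (j : ℕ) : H (j + 1) ≤ R * (S + 1) * H j := by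
  have h1 : ∑ i ∈ Finset.range (r j), s j i ≤ r j * S := by
    simpa using Finset.sum_le_card_nsmul (Finset.range (r j)) (s j) S
      fun i hi => hS j i (Finset.mem_range.mp hi)
  have h2 := towerHeight_pos (h₁ := h₁) (s := s) hr j
  calc H (j + 1) ≤ H j * r j + r j * S := by rw [towerHeight_succ]; gcongr
    _ ≤ H j * R + R * S := by gcongr <;> exact hR j
    _ ≤ H j * R + R * S * H j := 
      Nat.add_le_add_left (Nat.le_mul_of_pos_right _ h2) _
    _ = _ := by ring

theorem towerHeight_add_le (hr : ∀ j, 2 ≤ r j) {R S : ℕ} (hR : ∀ j, r j ≤ R)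
    (hS : ∀ j, ∀ i < r j, s j i ≤ S) (j m : ℕ) : H (j + m) ≤ (R * (S + 1)) ^ m * H j := by
  induction m with
  | zero => simp
  | succ m ih =>
    calc H (j + m + 1) ≤ R * (S + 1) * H (j + m) := towerHeight_succ_le hr hR hS _
      _ ≤ R * (S + 1) * ((R * (S + 1)) ^ m * H j) := by gcongr
      _ = _ := by ring

variable (h₁ r s)

/-- The position of the bottom of the `i`-th column of the `j`-th tower in the next tower. -/
def columnStart (j i : ℕ) : ℕ := ∑ k ∈ Finset.range i, (H j + s j k)

/-- The number of copies of the `j`-th tower contained in the tower number `j + m`. -/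
def blockCount : ℕ → ℕ → ℕ
  | _, 0 => 1
  | j, m + 1 => blockCount (j + 1) m * r j

/-- The position of the `n`-th copy of the `j`-th tower in the tower number `j + m`
(for `n < blockCount r j m`; the copies are numbered from `0`, from the bottom to the top). -/
def blockStart : ℕ → ℕ → ℕ → ℕ
  | _, 0, _ => 0
  | j, m + 1, n => blockStart (j + 1) m (n / r j) + columnStart h₁ r s j (n % r j)

variable {h₁ r s}

theorem columnStart_succ (j i : ℕ) :
    columnStart h₁ r s j (i + 1) = columnStart h₁ r s j i + H j + s j i := by
  rw [columnStart, Finset.sum_range_succ, add_assoc, columnStart]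

theorem columnStart_cut (j : ℕ) : columnStart h₁ r s j (r j) = H (j + 1) := by
  rw [columnStart, Finset.sum_add_distrib, towerHeight_succ]
  simp [mul_comm]

theorem columnStart_add_le {j i : ℕ} (hi : i < r j) : columnStart h₁ r s j i + H j ≤ H (j + 1) := by
  rw [← columnStart_cut (h₁ := h₁) (s := s) j]
  have h : columnStart h₁ r s j (i + 1) ≤ columnStart h₁ r s j (r j) := by
    unfold columnStart
    exact Finset.sum_le_sum_of_subset (Finset.range_mono hi)
  rw [columnStart_succ] at h
  omega

theorem two_pow_le_blockCount (hr : ∀ j, 2 ≤ r j) (j m : ℕ) : 2 ^ m ≤ blockCount r j m := by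
  induction m generalizing j with
  | zero => rfl
  | succ m ih => exact Nat.mul_le_mul (ih (j + 1)) (hr j)

theorem blockStart_zero (j m : ℕ) : blockStart h₁ r s j m 0 = 0 := by
  induction m generalizing j with
  | zero => rfl
  | succ m ih => simp [blockStart, ih, columnStart]

theorem blockStart_succ {S : ℕ} (hr : ∀ j, 2 ≤ r j) (hS : ∀ j, ∀ i < r j, s j i ≤ S) {j m n : ℕ}
    (hn : n + 1 < blockCount r j m) :
    ∃ g ≤ m * S, blockStart h₁ r s j m (n + 1) = blockStart h₁ r s j m n + H j + g := by
  induction m generalizing j n with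
  | zero => simp [blockCount] at hn
  | succ m ih =>
    have hj := hr j
    have hlt : n % r j < r j := Nat.mod_lt _ (by omega)
    simp only [blockStart]
    by_cases h : n % r j + 1 < r j
    · have h1 : (n + 1) % r j = n % r j + 1 := by
        rw [Nat.add_mod, Nat.mod_eq_of_lt (by omega : 1 < r j), Nat.mod_eq_of_lt h]
      have h2 : (n + 1) / r j = n / r j := by
        rw [Nat.succ_div, if_neg, add_zero]
        rw [Nat.dvd_iff_mod_eq_zero, h1]
        omega
      refine ⟨s j (n % r j), (hS j _ hlt).trans (Nat.le_mul_of_pos_left _ m.succ_pos), ?_⟩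
      rw [h1, h2, columnStart_succ]
      omega
    · have h0 : n % r j + 1 = r j := by omega
      have h1 : (n + 1) % r j = 0 := by
        rw [Nat.add_mod, Nat.mod_eq_of_lt (by omega : 1 < r j), h0, Nat.mod_self]
      have h2 : (n + 1) / r j = n / r j + 1 := by
        rw [Nat.succ_div, if_pos (Nat.dvd_of_mod_eq_zero h1)]
      have h3 : n / r j + 1 < blockCount r (j + 1) m := by
        rw [← h2]
        exact Nat.div_lt_of_lt_mul (by rw [mul_comm]; exact hn)
      obtain ⟨g, hg, he⟩ := ih h3
      have h4 := columnStart_succ (h₁ := h₁) (r := r) (s := s) j (n % r j)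
      rw [h0, columnStart_cut] at h4
      refine ⟨g + s j (n % r j), ?_, ?_⟩
      · rw [Nat.succ_mul]
        exact Nat.add_le_add hg (hS j _ hlt)
      · rw [h1, h2, he]
        simp only [columnStart, Finset.range_zero, Finset.sum_empty] at h4 ⊢
        omega

theorem blockStart_add_le (hr : ∀ j, 2 ≤ r j) {j m n : ℕ} (hn : n < blockCount r j m) :
    blockStart h₁ r s j m n + H j ≤ H (j + m) := by
  induction m generalizing j n with
  | zero => simp [blockStart]
  | succ m ih =>
    have hj := hr j
    have h1 : n / r j < blockCount r (j + 1) m :=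
      Nat.div_lt_of_lt_mul (by rw [mul_comm]; exact hn)
    have h2 := ih h1
    have h3 := columnStart_add_le (h₁ := h₁) (s := s) (Nat.mod_lt n (by omega : r j > 0))
    have h4 : j + 1 + m = j + (m + 1) := by omega
    rw [h4] at h2
    simp only [blockStart]
    omega

theorem le_blockStart_last {S : ℕ} (hr : ∀ j, 2 ≤ r j) (hS : ∀ j, ∀ i < r j, s j i ≤ S)
    (j m : ℕ) : H (j + m) ≤ blockStart h₁ r s j m (blockCount r j m - 1) + H j + m * S := by
  induction m generalizing j with
  | zero => simp
  | succ m ih =>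
    have hj := hr j
    have h2 := ih (j + 1)
    have hN : 0 < blockCount r (j + 1) m :=
      (pow_pos two_pos m).trans_le (two_pow_le_blockCount hr _ _)
    have h4 : j + 1 + m = j + (m + 1) := by omega
    have h5 : blockCount r (j + 1) m * r j - 1 =
        r j - 1 + (blockCount r (j + 1) m - 1) * r j := by
      obtain ⟨b, hb⟩ := Nat.exists_eq_add_of_lt hN
      rw [hb]
      simp only [zero_add, Nat.add_sub_cancel, Nat.add_mul, one_mul]
      omega
    have h6 : (blockCount r (j + 1) m * r j - 1) / r j = blockCount r (j + 1) m - 1 := by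
      rw [h5, Nat.add_mul_div_right _ _ (by omega), Nat.div_eq_of_lt (by omega), zero_add]
    have h7 : (blockCount r (j + 1) m * r j - 1) % r j = r j - 1 := by
      rw [h5, Nat.add_mul_mod_self_right, Nat.mod_eq_of_lt (by omega)]
    have h8 := columnStart_succ (h₁ := h₁) (r := r) (s := s) j (r j - 1)
    rw [Nat.sub_add_cancel (by omega), columnStart_cut] at h8
    have h9 := hS j (r j - 1) (by omega)
    rw [h4] at h2
    simp only [blockStart, blockCount, h6, h7, Nat.succ_mul]
    omega

end Blocks

/-! ### Hierarchies of blocks in the integers -/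

section Hierarchy

/-- The combinatorial structure of an orbit of a rank-one construction: `P j` is the set of the
times at which the orbit enters the base of the `j`-th tower. The interval of `towerHeight h₁ r s j`
integers that starts at an element of `P j` is called a `j`-block. -/
structure IsHierarchy (h₁ : ℕ) (r : ℕ → ℕ) (s : ℕ → ℕ → ℕ) (P : ℕ → Set ℤ) : Prop where
  mem_iff : ∀ j n, n ∈ P j ↔ ∃ i < r j, n - columnStart h₁ r s j i ∈ P (j + 1)
  eq_of_abs_lt : ∀ j, ∀ a ∈ P j, ∀ b ∈ P j, |a - b| < towerHeight h₁ r s j → a = b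

variable {h₁ : ℕ} {r : ℕ → ℕ} {s : ℕ → ℕ → ℕ} {P Q : ℕ → Set ℤ}

local notation "H" => towerHeight h₁ r s

namespace IsHierarchy

theorem mem_iff_blockStart (hP : IsHierarchy h₁ r s P) (hr : ∀ j, 2 ≤ r j) (j m : ℕ) (n : ℤ) :
    n ∈ P j ↔ ∃ k < blockCount r j m, n - blockStart h₁ r s j m k ∈ P (j + m) := by
  induction m generalizing j n with
  | zero => simp [blockCount, blockStart]
  | succ m ih =>
    have h4 : j + 1 + m = j + (m + 1) := by omega
    have hj := hr j
    rw [hP.mem_iff]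
    constructor
    · rintro ⟨i, hi, h⟩
      obtain ⟨k, hk, h⟩ := (ih (j + 1) _).mp h
      refine ⟨i + k * r j, ?_, ?_⟩
      · calc i + k * r j < (k + 1) * r j := by rw [Nat.succ_mul]; omega
          _ ≤ blockCount r (j + 1) m * r j := Nat.mul_le_mul_right _ hk
      · rw [blockStart, Nat.add_mul_div_right _ _ (by omega), Nat.div_eq_of_lt hi, zero_add,
          Nat.add_mul_mod_self_right, Nat.mod_eq_of_lt hi, ← h4]
        convert h using 1
        push_cast
        ring
    · rintro ⟨k, hk, h⟩
      refine ⟨k % r j, Nat.mod_lt _ (by omega), (ih (j + 1) _).mpr ⟨k / r j, ?_, ?_⟩⟩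
      · exact Nat.div_lt_of_lt_mul (by rw [mul_comm]; exact hk)
      · rw [blockStart, ← h4] at h
        convert h using 1
        push_cast
        ring

/-- The `j`-blocks that start in a block of a higher level are those prescribed by the
construction. -/
theorem exists_eq_blockStart (hP : IsHierarchy h₁ r s P) (hr : ∀ j, 2 ≤ r j) {j m : ℕ} {p q : ℤ}
    (hp : p ∈ P (j + m)) (hq : q ∈ P j) (hpq : p ≤ q) (hqp : q < p + H (j + m)) :
    ∃ k < blockCount r j m, q = p + blockStart h₁ r s j m k := by
  obtain ⟨k, hk, h⟩ := (hP.mem_iff_blockStart hr j m q).mp hq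
  refine ⟨k, hk, ?_⟩
  have h1 := blockStart_add_le (h₁ := h₁) (s := s) hr hk
  have h0 := towerHeight_pos (h₁ := h₁) (s := s) hr j
  have h2 := hP.eq_of_abs_lt _ _ hp _ h (by rw [abs_lt]; constructor <;> omega)
  omega

theorem add_blockStart_mem (hP : IsHierarchy h₁ r s P) (hr : ∀ j, 2 ≤ r j) {j m k : ℕ} {p : ℤ}
    (hp : p ∈ P (j + m)) (hk : k < blockCount r j m) : p + blockStart h₁ r s j m k ∈ P j :=
  (hP.mem_iff_blockStart hr j m _).mpr ⟨k, hk, by simpa using hp⟩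

/-- Two blocks of the same level have the same internal structure. -/
theorem mem_iff_add_mem (hP : IsHierarchy h₁ r s P) (hQ : IsHierarchy h₁ r s Q)
    (hr : ∀ j, 2 ≤ r j) {j l : ℕ} (hl : l ≤ j) {p q u : ℤ} (hp : p ∈ P j) (hq : q ∈ Q j)
    (hu : 0 ≤ u) (huH : u < H j) : p + u ∈ P l ↔ q + u ∈ Q l := by
  obtain ⟨m, rfl⟩ := Nat.exists_eq_add_of_le hl
  constructor
  · intro h
    obtain ⟨k, hk, h⟩ := hP.exists_eq_blockStart hr hp h (by omega) (by omega)
    rw [add_left_cancel h]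
    exact hQ.add_blockStart_mem hr hq hk
  · intro h
    obtain ⟨k, hk, h⟩ := hQ.exists_eq_blockStart hr hq h (by omega) (by omega)
    rw [add_left_cancel h]
    exact hP.add_blockStart_mem hr hp hk

end IsHierarchy

end Hierarchy

/-! ### Alignment of two hierarchies -/

section Alignment

variable {h₁ : ℕ} {r : ℕ → ℕ} {s : ℕ → ℕ → ℕ} {P Q : ℕ → Set ℤ}

local notation "H" => towerHeight h₁ r s

/-- The `n`-th copy of the `j`-th tower in the tower number `j + m` has two successors there, and
the numbers of spacers before the first and before the second successor are different. -/
def IsUnequalGap (h₁ : ℕ) (r : ℕ → ℕ) (s : ℕ → ℕ → ℕ) (j m n : ℕ) : Prop :=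
  n + 2 < blockCount r j m ∧
    blockStart h₁ r s j m n + blockStart h₁ r s j m (n + 2) ≠ 2 * blockStart h₁ r s j m (n + 1)

/-- A pair of overlapping `j`-blocks of `P` and `Q` has the offset `p' - p`. `NoDrift` says that the
offsets of two such pairs, not too far from `0`, do not differ by a nonzero integer that is at most
`M` in absolute value. The first pair overlaps along at least the part `1 / D` of its length. -/
def NoDrift (h₁ : ℕ) (r : ℕ → ℕ) (s : ℕ → ℕ → ℕ) (P Q : ℕ → Set ℤ) (K D M j : ℕ) : Prop :=
  ∀ p ∈ P j, ∀ q ∈ P j, ∀ p' ∈ Q j, ∀ q' ∈ Q j,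
    |p| ≤ K * towerHeight h₁ r s j → |q| ≤ K * towerHeight h₁ r s j →
    D * |p' - p| ≤ (D - 1) * towerHeight h₁ r s j → |(p' - p) - (q' - q)| ≤ M → p' - p = q' - q

/-- The time `0` lies in a `j`-block of `P` that is a translate by `-d` of a `j`-block of `Q`. -/
def AlignedAt (h₁ : ℕ) (r : ℕ → ℕ) (s : ℕ → ℕ → ℕ) (P Q : ℕ → Set ℤ) (j : ℕ) (d : ℤ) : Prop :=
  ∃ p ∈ P j, p ≤ 0 ∧ 0 < p + towerHeight h₁ r s j ∧ p + d ∈ Q j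

/-- In the hierarchy `P`, the time `0` lies in a `j`-block that is followed by unequal numbers of
spacers inside its `(j + m)`-block; in `Q`, it lies well inside a `(j + k)`-block. -/
def IsCentral (h₁ : ℕ) (r : ℕ → ℕ) (s : ℕ → ℕ → ℕ) (P Q : ℕ → Set ℤ) (m k j : ℕ) : Prop :=
  (∃ n, IsUnequalGap h₁ r s j m n ∧ ∃ a < towerHeight h₁ r s j,
    -((blockStart h₁ r s j m n : ℤ) + a) ∈ P (j + m)) ∧
  ∃ b : ℕ, 4 * towerHeight h₁ r s j ≤ b ∧
    b + 4 * towerHeight h₁ r s j < towerHeight h₁ r s (j + k) ∧ -(b : ℤ) ∈ Q (j + k)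

/-- Inside an aligned block, an offset that is a small but not very small part of the height of a
lower level `l` would give long overlaps with both neighbours, hence, by `NoDrift`, equal gaps
between all `l`-blocks. -/
theorem AlignedAt.mul_abs_le (hP : IsHierarchy h₁ r s P) (hQ : IsHierarchy h₁ r s Q)
    (hr : ∀ j, 2 ≤ r j) {S : ℕ} (hS : ∀ j, ∀ i < r j, s j i ≤ S) {K D M l m j n : ℕ} {d : ℤ}
    (hd : AlignedAt h₁ r s P Q j d) (hj : l + m ≤ j) (hn : IsUnequalGap h₁ r s l m n)
    (hzero : ∃ p ∈ P (l + m), p ≤ 0 ∧ 0 < p + H (l + m))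
    (hND : NoDrift h₁ r s P Q K (2 * D) M l) (hK : H (l + m) ≤ K * H l) (hM : m * S ≤ M)
    (hDM : 2 * D * M ≤ H l) (hsmall : 8 * |d| ≤ H l) : D * |d| ≤ H l := by
  obtain ⟨p, hp, hp0, hpH, hpd⟩ := hd
  obtain ⟨t, rfl⟩ := Nat.exists_eq_add_of_le hj
  obtain ⟨p₀, hp₀, hp₀0, hp₀H⟩ := hzero
  -- the `(l + m)`-block at the time `0` lies in the aligned `j`-block, hence is aligned itself
  have hle : p ≤ p₀ := by
    by_contra! h
    have h1 : p ∈ P (l + m) := by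
      have := hP.add_blockStart_mem hr hp
        ((pow_pos two_pos t).trans_le (two_pow_le_blockCount hr (l + m) t))
      rwa [blockStart_zero, Nat.cast_zero, add_zero] at this
    have := hP.eq_of_abs_lt _ _ h1 _ hp₀ (by rw [abs_lt]; constructor <;> omega)
    omega
  obtain ⟨k, hk, hk'⟩ := hP.exists_eq_blockStart hr hp hp₀ hle (by omega)
  have hp₀d : p₀ + d ∈ Q (l + m) := by
    have := hQ.add_blockStart_mem hr hpd hk
    rwa [hk', add_right_comm]
  obtain ⟨hn, hne⟩ := hn
  obtain ⟨g₁, hg₁, e₁⟩ := blockStart_succ (h₁ := h₁) hr hS (by omega : n + 1 < blockCount r l m)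
  obtain ⟨g₂, hg₂, e₂⟩ : ∃ g ≤ m * S, blockStart h₁ r s l m (n + 2) =
      blockStart h₁ r s l m (n + 1) + H l + g := blockStart_succ hr hS hn
  have hg : g₁ ≠ g₂ := by rintro rfl; exact hne (by omega)
  have hb := blockStart_add_le (h₁ := h₁) (s := s) hr hn
  have m₀ := hP.add_blockStart_mem hr hp₀ (by omega : n < blockCount r l m)
  have m₁ := hP.add_blockStart_mem hr hp₀ (by omega : n + 1 < blockCount r l m)
  have m₂ := hP.add_blockStart_mem hr hp₀ hn
  have m₀' := hQ.add_blockStart_mem hr hp₀d (by omega : n < blockCount r l m)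
  have m₁' := hQ.add_blockStart_mem hr hp₀d (by omega : n + 1 < blockCount r l m)
  have m₂' := hQ.add_blockStart_mem hr hp₀d hn
  have hK' : (H (l + m) : ℤ) ≤ K * H l := by exact_mod_cast hK
  have hDg : ∀ g : ℕ, g ≤ m * S → 2 * (D : ℤ) * g ≤ H l := by
    intro g hg
    exact_mod_cast (Nat.mul_le_mul_left _ (hg.trans hM)).trans hDM
  have hDg₁ := hDg g₁ hg₁
  -- compare the long overlaps of consecutive blocks, the later one of which is in `P` if `0 ≤ d`
  -- and in `Q` if `d ≤ 0`
  by_contra! hlt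
  rcases le_total 0 d with h0 | h0
  · rw [abs_of_nonneg h0] at hlt hsmall
    have := hND _ m₁ _ m₂ _ m₀' _ m₁' (by rw [abs_le]; constructor <;> omega)
      (by rw [abs_le]; constructor <;> omega) ?_ (by rw [abs_le]; constructor <;> omega)
    · omega
    · rw [abs_of_nonpos (by omega), e₁]
      push_cast
      linarith
  · rw [abs_of_nonpos h0] at hlt hsmall
    have := hND _ m₀ _ m₁ _ m₁' _ m₂' (by rw [abs_le]; constructor <;> omega)
      (by rw [abs_le]; constructor <;> omega) ?_ (by rw [abs_le]; constructor <;> omega)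
    · omega
    · rw [abs_of_nonneg (by omega), e₁]
      push_cast
      linarith

/-- At a central time, the `j`-block of `P` at `0` either starts close to the start of a `j`-block
of `Q`, or overlaps two `j`-blocks of `Q` along substantial parts. In the second case, `NoDrift`
would show that the gap between these two is equal to each of the two following gaps of `P`. -/
theorem IsCentral.exists_alignedAt (hP : IsHierarchy h₁ r s P) (hQ : IsHierarchy h₁ r s Q)
    (hr : ∀ j, 2 ≤ r j) {S : ℕ} (hS : ∀ j, ∀ i < r j, s j i ≤ S) {K D m k j : ℕ} (hD : 0 < D)
    (hc : IsCentral h₁ r s P Q m k j) (hmk : m ≤ k)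
    (hND : NoDrift h₁ r s P Q K (2 * D) (k * S) j) (hK : H (j + m) ≤ K * H j)
    (hDM : 2 * D * (k * S) ≤ H j) : ∃ d, AlignedAt h₁ r s P Q j d ∧ D * |d| ≤ 2 * H j := by
  obtain ⟨⟨n, ⟨hn, hne⟩, a, ha, hp₀⟩, b, hb, hbH, hp'⟩ := hc
  have hmS : m * S ≤ k * S := Nat.mul_le_mul_right _ hmk
  have hDg : ∀ g : ℕ, g ≤ k * S → 2 * (D : ℤ) * g ≤ H j := by
    intro g hg
    exact_mod_cast (Nat.mul_le_mul_left _ hg).trans hDM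
  have hgH : ∀ g : ℕ, g ≤ k * S → g ≤ H j := by
    intro g hg
    refine hg.trans (le_trans ?_ hDM)
    exact Nat.le_mul_of_pos_left _ (by omega)
  -- the block of `P` at the time `0` and its two successors
  obtain ⟨g₁, hg₁, e₁⟩ := blockStart_succ (h₁ := h₁) hr hS (by omega : n + 1 < blockCount r j m)
  obtain ⟨g₂, hg₂, e₂⟩ : ∃ g ≤ m * S, blockStart h₁ r s j m (n + 2) =
      blockStart h₁ r s j m (n + 1) + H j + g := blockStart_succ hr hS hn
  have hg : g₁ ≠ g₂ := by rintro rfl; exact hne (by omega)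
  have hbd := blockStart_add_le (h₁ := h₁) (s := s) hr hn
  have m₁ := hP.add_blockStart_mem hr hp₀ (by omega : n < blockCount r j m)
  have m₂ := hP.add_blockStart_mem hr hp₀ (by omega : n + 1 < blockCount r j m)
  have m₃ := hP.add_blockStart_mem hr hp₀ hn
  have hK' : (H (j + m) : ℤ) ≤ K * H j := by exact_mod_cast hK
  -- the first block of `Q` that does not start before the block of `P` at the time `0`
  have hlast := le_blockStart_last (h₁ := h₁) hr hS j k
  have hkS := hgH _ le_rfl
  have hex : ∃ i, b - a ≤ blockStart h₁ r s j k i := ⟨blockCount r j k - 1, by omega⟩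
  classical
  obtain ⟨i, hi, hmin⟩ : ∃ i, b - a ≤ blockStart h₁ r s j k i ∧
      ∀ i' < i, blockStart h₁ r s j k i' < b - a :=
    ⟨Nat.find hex, Nat.find_spec hex, fun i' h => not_le.mp (Nat.find_min hex h)⟩
  have hNpos := (pow_pos two_pos k).trans_le (two_pow_le_blockCount hr j k)
  have hi0 : i ≠ 0 := by
    rintro rfl
    rw [blockStart_zero] at hi
    omega
  obtain ⟨i, rfl⟩ := Nat.exists_eq_succ_of_ne_zero hi0
  have hiN : i + 1 ≤ blockCount r j k - 1 := by
    by_contra! h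
    have := hmin _ h
    omega
  have hprev := hmin i (Nat.lt_succ_self i)
  obtain ⟨g₀', hg₀', e₀'⟩ := blockStart_succ (h₁ := h₁) hr hS
    (by omega : i + 1 < blockCount r j k)
  have hiN' : i + 1 + 1 < blockCount r j k := by
    rcases hiN.lt_or_eq with h | h
    · omega
    · have := hgH _ hg₀'
      rw [← h] at hlast
      simp only [Nat.succ_eq_add_one] at *
      omega
  obtain ⟨g₁', hg₁', e₁'⟩ := blockStart_succ (h₁ := h₁) hr hS hiN'
  have m₀' := hQ.add_blockStart_mem hr hp' (by omega : i < blockCount r j k)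
  have m₁' := hQ.add_blockStart_mem hr hp' (by omega : i + 1 < blockCount r j k)
  have m₂' := hQ.add_blockStart_mem hr hp' hiN'
  simp only [Nat.succ_eq_add_one] at *
  obtain ⟨d, hd⟩ : ∃ d : ℤ, d = blockStart h₁ r s j k (i + 1) - (b - a) := ⟨_, rfl⟩
  have hd0 : 0 ≤ d := by omega
  have hdH : d < H j + g₀' := by omega
  have hDg₀' := hDg g₀' hg₀'
  have hDg₁ := hDg g₁ (hg₁.trans hmS)
  -- align with this block of `Q` or with the preceding one, if one of them starts close enough
  by_cases c₁ : D * d ≤ 2 * H j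
  · exact ⟨d, ⟨_, m₁, by omega, by omega, by convert m₁' using 1; omega⟩,
      by rwa [abs_of_nonneg hd0]⟩
  by_cases c₂ : D * (H j + g₀' - d) ≤ 2 * H j
  · refine ⟨d - H j - g₀', ⟨_, m₁, by omega, by omega, by convert m₀' using 1; omega⟩, ?_⟩
    rw [abs_of_nonpos (by omega)]
    linarith
  exfalso
  push Not at c₁ c₂
  have hdlt : d < H j := by
    by_contra! h
    have h1 : (D : ℤ) * (H j + g₀' - d) ≤ D * g₀' := by gcongr; omega
    linarith
  -- two successive overlaps in which the block of `P` starts first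
  have hg₁' : g₁' = g₁ := by
    have := hND _ m₁ _ m₂ _ m₁' _ m₂' (by rw [abs_le]; constructor <;> omega)
      (by rw [abs_le]; constructor <;> omega) ?_ (by rw [abs_le]; constructor <;> omega)
    · omega
    · rw [show -(b : ℤ) + blockStart h₁ r s j k (i + 1) -
        (-((blockStart h₁ r s j m n : ℤ) + a) + blockStart h₁ r s j m n) = d by omega,
        abs_of_nonneg hd0]
      push_cast
      linarith
  -- two successive overlaps in which the block of `Q` starts first
  have hg₂' : g₁' = g₂ := by
    have := hND _ m₂ _ m₃ _ m₁' _ m₂' (by rw [abs_le]; constructor <;> omega)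
      (by rw [abs_le]; constructor <;> omega) ?_ (by rw [abs_le]; constructor <;> omega)
    · omega
    · rw [show -(b : ℤ) + blockStart h₁ r s j k (i + 1) -
        (-((blockStart h₁ r s j m n : ℤ) + a) + blockStart h₁ r s j m (n + 1)) =
        -(H j + g₁ - d) by omega, abs_neg, abs_of_nonneg (by omega)]
      push_cast
      linarith
  exact hg (hg₁'.symm.trans hg₂')

/-- If the time `0` is central for infinitely many levels, then an offset of alignment of one of
these levels descends to all lower levels from some level on, and is therefore bounded. -/
theorem exists_frequently_alignedAt (hP : IsHierarchy h₁ r s P) (hQ : IsHierarchy h₁ r s Q)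
    (hr : ∀ j, 2 ≤ r j) {R S : ℕ} (hR : ∀ j, r j ≤ R) (hS : ∀ j, ∀ i < r j, s j i ≤ S) {m k : ℕ}
    (hmk : m ≤ k) (hgap : ∀ᶠ j in atTop, ∃ n, IsUnequalGap h₁ r s j m n)
    (hzero : ∀ᶠ j in atTop, ∃ p ∈ P j, p ≤ 0 ∧ 0 < p + H j)
    (hND : ∀ᶠ j in atTop, NoDrift h₁ r s P Q ((R * (S + 1)) ^ m)
      (2 * (16 * (R * (S + 1)) ^ (m + 1))) (k * S) j)
    (hc : ∃ᶠ j in atTop, IsCentral h₁ r s P Q m k j) :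
    ∃ d, ∃ᶠ j in atTop, AlignedAt h₁ r s P Q j d := by
  -- heights grow at most by the factor `C` at each step; `D` is large enough that an offset of at
  -- most `2 / D` of the height of level `j` is at most `1 / 8` of the height of level `j - m`, and
  -- an offset of at most `1 / D` of the height of a level is at most `1 / 8` of the previous height
  set C := R * (S + 1) with hCdef
  set D := 16 * C ^ (m + 1) with hDdef
  have hC : 0 < C := Nat.mul_pos (by have := hr 0; have := hR 0; omega) (Nat.succ_pos S)
  have hCm : 0 < C ^ m := pow_pos hC m
  have hD : 0 < D := Nat.mul_pos (by norm_num) (pow_pos hC _)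
  have hlarge : ∀ᶠ j in atTop, 2 * D * (k * S) ≤ H j :=
    (tendsto_towerHeight hr).eventually_ge_atTop _
  obtain ⟨j₀, hj₀⟩ := eventually_atTop.mp (hgap.and (hzero.and (hND.and hlarge)))
  have hK : ∀ l, H (l + m) ≤ C ^ m * H l := fun l => towerHeight_add_le hr hR hS l m
  have hfreq : ∃ᶠ j in atTop, ∃ d ∈ Set.Icc (-(H j₀ : ℤ)) (H j₀), AlignedAt h₁ r s P Q j d := by
    refine (hc.and_eventually (eventually_ge_atTop (j₀ + m))).mono fun j ⟨hcj, hj⟩ => ?_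
    obtain ⟨-, -, hNDj, hlj⟩ := hj₀ j (by omega)
    obtain ⟨d, hd, hdle⟩ := hcj.exists_alignedAt hP hQ hr hS hD hmk hNDj (hK j) hlj
    refine ⟨d, ?_, hd⟩
    -- downward induction on the level `l`, from `j - m` to `j₀`
    have hdesc : ∀ t l, l + m + t = j → j₀ ≤ l → 8 * |d| ≤ H l := by
      intro t
      induction t with
      | zero =>
        intro l hl _
        have h1 : (H j : ℤ) ≤ C ^ m * H l := by rw [← hl]; exact_mod_cast hK l
        have h2 : (C : ℤ) ^ m * (8 * |d|) ≤ C ^ m * H l := by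
          have h3 : (1 : ℤ) ≤ C := by exact_mod_cast hC
          have h4 : (C : ℤ) ^ m * |d| ≤ C * (C ^ m * |d|) :=
            le_mul_of_one_le_left (by positivity) h3
          have h5 : (D : ℤ) * |d| = 16 * (C * (C ^ m * |d|)) := by
            rw [hDdef]; push_cast; ring
          linarith
        exact le_of_mul_le_mul_left h2 (by exact_mod_cast hCm)
      | succ t ih =>
        intro l hl hjl
        obtain ⟨⟨n, hn⟩, -, hNDl, hll⟩ := hj₀ (l + 1) (by omega)
        have h1 := hd.mul_abs_le hP hQ hr hS (by omega) hn (hj₀ (l + 1 + m) (by omega)).2.1 hNDl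
          (hK (l + 1)) (Nat.mul_le_mul_right _ hmk) hll (ih (l + 1) (by omega) (by omega))
        have h2 : (H (l + 1) : ℤ) ≤ C * H l := by exact_mod_cast towerHeight_succ_le hr hR hS l
        have h3 : (C : ℤ) * (8 * |d|) ≤ C * H l := by
          have h3 : (1 : ℤ) ≤ C ^ m := by exact_mod_cast hCm
          have h4 : (C : ℤ) * |d| ≤ C ^ m * (C * |d|) :=
            le_mul_of_one_le_left (by positivity) h3
          have h5 : (D : ℤ) * |d| = 16 * (C ^ m * (C * |d|)) := by
            rw [hDdef]; push_cast; ring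
          have h6 : (0 : ℤ) ≤ C * |d| := by positivity
          linarith
        exact le_of_mul_le_mul_left h3 (by exact_mod_cast hC)
    have h := hdesc (j - (j₀ + m)) j₀ (by omega) le_rfl
    have h' := abs_nonneg d
    exact Set.mem_Icc.mpr (abs_le.mp (by omega))
  by_contra! hno
  refine hfreq ?_
  filter_upwards [(Set.finite_Icc (-(H j₀ : ℤ)) (H j₀)).eventually_all.mpr
    fun d _ => hno d] with j hj
  rintro ⟨d, hd, hda⟩
  exact hj d hd hda

/-- Since the blocks at the time `0` exhaust the integers, an offset that aligns infinitely many of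
them matches the hierarchies completely. -/
theorem mem_iff_add_mem_of_frequently_alignedAt (hP : IsHierarchy h₁ r s P)
    (hQ : IsHierarchy h₁ r s Q) (hr : ∀ j, 2 ≤ r j)
    (hex : ∀ N : ℕ, ∀ᶠ j in atTop, ∃ p ∈ P j, p ≤ -N ∧ N < p + H j) {d : ℤ}
    (hd : ∃ᶠ j in atTop, AlignedAt h₁ r s P Q j d) (l : ℕ) (n : ℤ) : n ∈ P l ↔ n + d ∈ Q l := by
  obtain ⟨j, ⟨q, hq, hq0, hqH, hqd⟩, hlj, p, hp, hpn, hpH⟩ :=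
    (hd.and_eventually ((eventually_ge_atTop l).and (hex n.natAbs))).exists
  obtain rfl := hP.eq_of_abs_lt _ _ hp _ hq (by rw [abs_lt]; constructor <;> omega)
  have := hP.mem_iff_add_mem hQ hr hlj hp hqd (u := n - p) (by omega) (by omega)
  convert this using 2 <;> ring

end Alignment

/-! ### The hierarchy of an orbit -/

section Orbits

variable {X : Type*} [MeasurableSpace X] {μ : Measure X} {T : X ≃ᵐ X}
  {h₁ : ℕ} {r : ℕ → ℕ} {s : ℕ → ℕ → ℕ} {E : ℕ → Set X} {C : ℕ → ℕ → Set X}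

local notation "H" => towerHeight h₁ r s

theorem measurePreserving_power (hT : MeasurePreserving T μ μ) (n : ℤ) :
    MeasurePreserving (power T n) μ μ := by
  refine ⟨measurable_power T n, ?_⟩
  obtain ⟨k, rfl | rfl⟩ := n.eq_nat_or_neg
  · rw [funext (power_natCast T k)]
    exact (hT.iterate k).map_eq
  · rw [funext (power_neg_natCast T k)]
    exact ((hT.symm T).iterate k).map_eq

theorem measureReal_power_preimage (hT : MeasurePreserving T μ μ) (n : ℤ) {A : Set X}
    (hA : MeasurableSet A) : μ.real {x | power T n x ∈ A} = μ.real A :=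
  (measurePreserving_power hT n).measureReal_preimage hA.nullMeasurableSet

theorem iterate_image_eq (T : X ≃ᵐ X) (k : ℕ) (A : Set X) :
    T^[k] '' A = {x | power T (-k) x ∈ A} := by
  ext x
  simp only [Set.mem_image, Set.mem_ofPred_eq]
  constructor
  · rintro ⟨y, hy, rfl⟩
    rwa [← power_natCast, ← power_add, neg_add_cancel, power_zero]
  · intro h
    exact ⟨_, h, by rw [← power_natCast, ← power_add, add_neg_cancel, power_zero]⟩

/-- The set of the times at which the orbit of `x` visits the set `E j`. -/
def visits (T : X ≃ᵐ X) (E : ℕ → Set X) (x : X) (j : ℕ) : Set ℤ := {n | power T n x ∈ E j}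

theorem mem_visits {x : X} {j : ℕ} {n : ℤ} : n ∈ visits T E x j ↔ power T n x ∈ E j := Iff.rfl

theorem mem_visits_power {x : X} {j : ℕ} {n t : ℤ} :
    n ∈ visits T E (power T t x) j ↔ n + t ∈ visits T E x j := by
  rw [mem_visits, mem_visits, power_add]

namespace IsCuttingAndStacking

theorem mem_column_iff (h : IsCuttingAndStacking μ T h₁ r s E C) {j i : ℕ} (hi : i < r j) (x : X) :
    x ∈ C j i ↔ power T (-(columnStart h₁ r s j i : ℤ)) x ∈ E (j + 1) := by
  induction i generalizing x with
  | zero => simp [columnStart, power_zero, h.base_succ]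
  | succ i ih =>
    rw [← h.stack j i hi, iterate_image_eq, Set.mem_ofPred_eq, ih (by omega), ← power_add,
      columnStart_succ]
    congr! 2
    push_cast
    ring

theorem isHierarchy (h : IsCuttingAndStacking μ T h₁ r s E C) (x : X) :
    IsHierarchy h₁ r s (visits T E x) where
  mem_iff j n := by
    rw [mem_visits, h.base_eq_iUnion]
    simp only [Set.mem_iUnion, Finset.mem_range, exists_prop]
    refine exists_congr fun i => and_congr_right fun hi => ?_
    rw [h.mem_column_iff hi, ← power_add, mem_visits, neg_add_eq_sub]
  eq_of_abs_lt j := by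
    have key : ∀ a ∈ visits T E x j, ∀ b ∈ visits T E x j, a < b → b < a + H j → False := by
      intro a ha b hb hab hlt
      obtain ⟨k, hk⟩ := Int.eq_ofNat_of_zero_le (sub_nonneg.mpr hab.le)
      obtain rfl : b = a + k := by omega
      have hd := h.disjoint_levels j (show 0 < H j by omega) (show k < H j by omega)
        (show 0 ≠ k by omega)
      simp only [Function.onFun, Function.iterate_zero, Set.image_id, iterate_image_eq] at hd
      refine Set.disjoint_left.mp hd hb ?_
      rw [Set.mem_ofPred_eq, ← power_add, show -(k : ℤ) + (a + k) = a by ring]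
      exact ha
    intro a ha b hb hab
    rw [abs_lt] at hab
    rcases lt_trichotomy a b with hlt | rfl | hlt
    · exact (key a ha b hb hlt (by omega)).elim
    · rfl
    · exact (key b hb a ha hlt (by omega)).elim

theorem measurableSet_mem_visits (h : IsCuttingAndStacking μ T h₁ r s E C) (j : ℕ) (n : ℤ) :
    MeasurableSet {x | n ∈ visits T E x j} :=
  measurable_power T n (h.measurableSet_base j)

theorem measureReal_mem_visits (h : IsCuttingAndStacking μ T h₁ r s E C)
    (hT : MeasurePreserving T μ μ) (j : ℕ) (n : ℤ) :
    μ.real {x | n ∈ visits T E x j} = μ.real (E j) :=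
  measureReal_power_preimage hT n (h.measurableSet_base j)

theorem iUnion_levels_eq (j : ℕ) (F : Finset ℕ) :
    ⋃ k ∈ F, T^[k] '' E j = {x | ∃ k ∈ F, -(k : ℤ) ∈ visits T E x j} := by
  ext x
  simp [iterate_image_eq, mem_visits]

theorem measurableSet_levels (h : IsCuttingAndStacking μ T h₁ r s E C) (j : ℕ) (F : Finset ℕ) :
    MeasurableSet {x | ∃ k ∈ F, -(k : ℤ) ∈ visits T E x j} := by
  have : {x | ∃ k ∈ F, -(k : ℤ) ∈ visits T E x j} =
      ⋃ k ∈ F, {x | -(k : ℤ) ∈ visits T E x j} := by ext; simp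
  rw [this]
  exact Finset.measurableSet_biUnion _ fun k _ => h.measurableSet_mem_visits j _

variable [IsProbabilityMeasure μ]

theorem eventually_exists_levels (h : IsCuttingAndStacking μ T h₁ r s E C) {A : Set X}
    (hA : MeasurableSet A) {ε : ℝ} (hε : 0 < ε) : ∀ᶠ j in atTop, ∃ F : Finset ℕ,
      (∀ k ∈ F, k < H j) ∧ μ.real (A ∆ {x | ∃ k ∈ F, -(k : ℤ) ∈ visits T E x j}) < ε := by
  obtain ⟨J, hJ⟩ := h.approx A hA (ENNReal.ofReal ε) (ENNReal.ofReal_pos.mpr hε)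
  filter_upwards [eventually_ge_atTop J] with j hj
  obtain ⟨F, hF, hlt⟩ := hJ j hj
  rw [iUnion_levels_eq] at hlt
  exact ⟨F, hF, (ENNReal.lt_ofReal_iff_toReal_lt (measure_ne_top _ _)).mp hlt⟩

theorem towerHeight_mul_measureReal_le (h : IsCuttingAndStacking μ T h₁ r s E C)
    (hT : MeasurePreserving T μ μ) (j : ℕ) : H j * μ.real (E j) ≤ 1 := by
  have h1 : μ.real (⋃ k ∈ Finset.range (H j), {x | -(k : ℤ) ∈ visits T E x j}) =
      ∑ k ∈ Finset.range (H j), μ.real {x | -(k : ℤ) ∈ visits T E x j} := by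
    refine measureReal_biUnion_finset (fun a ha b hb hab => ?_)
      (fun k _ => h.measurableSet_mem_visits j _)
    refine Set.disjoint_left.mpr fun x hx hx' => hab ?_
    have ha := Finset.mem_range.mp ha
    have hb := Finset.mem_range.mp hb
    have := (h.isHierarchy x).eq_of_abs_lt j _ hx _ hx' (by rw [abs_lt]; constructor <;> omega)
    omega
  simp only [h.measureReal_mem_visits hT, Finset.sum_const, Finset.card_range, nsmul_eq_mul] at h1
  rw [← h1]
  exact measureReal_le_one

theorem towerHeight_mul_measureReal_add_le (h : IsCuttingAndStacking μ T h₁ r s E C)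
    (hT : MeasurePreserving T μ μ) (hr : ∀ j, 2 ≤ r j) (j m : ℕ) :
    H j * μ.real (E (j + m)) ≤ 1 / 2 ^ m := by
  rw [le_div_iff₀ (by positivity)]
  calc (H j : ℝ) * μ.real (E (j + m)) * 2 ^ m = (2 ^ m * H j) * μ.real (E (j + m)) := by ring
    _ ≤ H (j + m) * μ.real (E (j + m)) := by
      gcongr
      exact_mod_cast two_pow_mul_towerHeight_le hr j m
    _ ≤ 1 := h.towerHeight_mul_measureReal_le hT _

end IsCuttingAndStacking

variable (T h₁ r s E)

/-- The points whose orbit is in one block of level `j` during the whole time from `-w` to `w`. In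
particular, `towerCore T h₁ r s E j 0` is the union of the levels of the `j`-th tower. -/
def towerCore (j w : ℕ) : Set X :=
  {x | ∃ p ∈ visits T E x j, p ≤ -(w : ℤ) ∧ (w : ℤ) < p + towerHeight h₁ r s j}

variable {T h₁ r s E}

namespace IsCuttingAndStacking

theorem measurableSet_towerCore (h : IsCuttingAndStacking μ T h₁ r s E C) (j w : ℕ) :
    MeasurableSet (towerCore T h₁ r s E j w) := by
  have : towerCore T h₁ r s E j w = ⋃ p : ℤ, ⋃ _ : p ≤ -(w : ℤ) ∧ (w : ℤ) < p + H j,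
      {x | p ∈ visits T E x j} := by
    ext x
    simp only [towerCore, Set.mem_ofPred_eq, Set.mem_iUnion, exists_prop]
    exact exists_congr fun p => and_comm
  rw [this]
  exact MeasurableSet.iUnion fun p => MeasurableSet.iUnion fun _ => h.measurableSet_mem_visits j p

theorem towerCore_mono (h : IsCuttingAndStacking μ T h₁ r s E C) (w : ℕ) :
    Monotone fun j => towerCore T h₁ r s E j w := by
  refine monotone_nat_of_le_succ fun j x => ?_
  rintro ⟨p, hp, hp1, hp2⟩
  obtain ⟨i, hi, hpi⟩ := ((h.isHierarchy x).mem_iff j p).mp hp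
  have := columnStart_add_le (h₁ := h₁) (s := s) hi
  exact ⟨_, hpi, by omega, by omega⟩

variable [IsProbabilityMeasure μ]

theorem tendsto_measureReal_tower_compl (h : IsCuttingAndStacking μ T h₁ r s E C) :
    Tendsto (fun j => μ.real (towerCore T h₁ r s E j 0)ᶜ) atTop (𝓝 0) := by
  rw [Metric.tendsto_atTop']
  intro ε hε
  obtain ⟨J, hJ⟩ := eventually_atTop.mp (h.eventually_exists_levels MeasurableSet.univ hε)
  refine ⟨J, fun j hj => ?_⟩
  obtain ⟨F, hF, hlt⟩ := hJ j hj.le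
  rw [Real.dist_0_eq_abs, abs_of_nonneg measureReal_nonneg]
  refine lt_of_le_of_lt (measureReal_mono ?_) hlt
  intro x hx
  refine Or.inl ⟨trivial, fun ⟨k, hk, hkx⟩ => hx ⟨_, hkx, ?_, ?_⟩⟩
  · simp
  · have := hF k hk
    push_cast
    omega

theorem measureReal_tower_le (h : IsCuttingAndStacking μ T h₁ r s E C)
    (hT : MeasurePreserving T μ μ) (j : ℕ) :
    μ.real (towerCore T h₁ r s E j 0) ≤ H j * μ.real (E j) := by
  have h1 : towerCore T h₁ r s E j 0 ⊆
      ⋃ k ∈ Finset.range (H j), {x | -(k : ℤ) ∈ visits T E x j} := by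
    rintro x ⟨p, hp, hp1, hp2⟩
    simp only [Set.mem_iUnion, Finset.mem_range, exists_prop]
    refine ⟨(-p).toNat, by omega, ?_⟩
    rwa [Set.mem_ofPred_eq, show -(((-p).toNat : ℕ) : ℤ) = p by omega]
  refine (measureReal_mono h1 (measure_ne_top _ _)).trans
    ((measureReal_biUnion_finset_le _ _).trans ?_)
  simp [h.measureReal_mem_visits hT]

theorem measureReal_towerCore_compl_le (h : IsCuttingAndStacking μ T h₁ r s E C)
    (hT : MeasurePreserving T μ μ) (j w : ℕ) :
    μ.real (towerCore T h₁ r s E j w)ᶜ ≤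
      μ.real (towerCore T h₁ r s E j 0)ᶜ + 2 * w * μ.real (E j) := by
  have h1 : (towerCore T h₁ r s E j w)ᶜ ⊆ (towerCore T h₁ r s E j 0)ᶜ ∪
      ((⋃ k ∈ Finset.range w, {x | -(k : ℤ) ∈ visits T E x j}) ∪
        ⋃ k ∈ Finset.range w, {x | (k : ℤ) + 1 - H j ∈ visits T E x j}) := by
    intro x hx
    by_contra hx'
    simp only [Set.mem_union, not_or, Set.mem_compl_iff, not_not, Set.mem_iUnion,
      Finset.mem_range, exists_prop, not_exists, not_and, Set.mem_ofPred_eq] at hx'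
    obtain ⟨⟨p, hp, hp1, hp2⟩, h2, h3⟩ := hx'
    refine hx ⟨p, hp, ?_, ?_⟩
    · by_contra! hlt
      refine h2 (-p).toNat (by omega) ?_
      rwa [show -(((-p).toNat : ℕ) : ℤ) = p by omega]
    · by_contra! hlt
      refine h3 (p + H j - 1).toNat (by omega) ?_
      rwa [show (((p + H j - 1).toNat : ℕ) : ℤ) + 1 - H j = p by omega]
  refine (measureReal_mono h1).trans ((measureReal_union_le _ _).trans ?_)
  gcongr
  refine (measureReal_union_le _ _).trans ?_
  have h2 := measureReal_biUnion_finset_le (μ := μ) (Finset.range w)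
    fun k => {x | -(k : ℤ) ∈ visits T E x j}
  have h3 := measureReal_biUnion_finset_le (μ := μ) (Finset.range w)
    fun k => {x | (k : ℤ) + 1 - H j ∈ visits T E x j}
  simp only [h.measureReal_mem_visits hT, Finset.sum_const, Finset.card_range, nsmul_eq_mul]
    at h2 h3
  linarith

/-- The blocks around a point exhaust its orbit. -/
theorem ae_eventually_mem_towerCore (h : IsCuttingAndStacking μ T h₁ r s E C)
    (hT : MeasurePreserving T μ μ) (hr : ∀ j, 2 ≤ r j) :
    ∀ᵐ x ∂μ, ∀ w : ℕ, ∀ᶠ j in atTop, x ∈ towerCore T h₁ r s E j w := by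
  rw [ae_all_iff]
  intro w
  have hE : Tendsto (fun j => μ.real (E j)) atTop (𝓝 0) := by
    refine squeeze_zero (fun _ => measureReal_nonneg) (fun j => ?_)
      (tendsto_inv_atTop_zero.comp (tendsto_natCast_atTop_atTop.comp
        (tendsto_towerHeight (h₁ := h₁) (s := s) hr)))
    have hpos : (0 : ℝ) < H j := by exact_mod_cast towerHeight_pos hr j
    rw [Function.comp_apply, Function.comp_apply, ← one_div, le_div_iff₀ hpos, mul_comm]
    exact h.towerHeight_mul_measureReal_le hT j
  have hlim : Tendsto (fun j => μ.real (towerCore T h₁ r s E j w)ᶜ) atTop (𝓝 0) := by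
    refine squeeze_zero (fun _ => measureReal_nonneg)
      (fun j => h.measureReal_towerCore_compl_le hT j w) ?_
    simpa using h.tendsto_measureReal_tower_compl.add (hE.const_mul (2 * (w : ℝ)))
  have hnull : μ.real (⋂ j, (towerCore T h₁ r s E j w)ᶜ) = 0 :=
    le_antisymm (ge_of_tendsto' hlim fun j => measureReal_mono (Set.iInter_subset _ j))
      measureReal_nonneg
  have hnull' : μ (⋂ j, (towerCore T h₁ r s E j w)ᶜ) = 0 :=
    (measureReal_eq_zero_iff).mp hnull
  filter_upwards [measure_eq_zero_iff_ae_notMem.mp hnull'] with x hx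
  simp only [Set.mem_iInter, Set.mem_compl_iff, not_forall, not_not] at hx
  obtain ⟨j, hj⟩ := hx
  filter_upwards [eventually_ge_atTop j] with i hi
  exact h.towerCore_mono w hi hj

end IsCuttingAndStacking

/-! ### Non-rigidity gives unequal gaps -/

/-- If the gaps between the copies of the `j`-th tower in the tower number `j + m` are all equal,
then the translation from one copy to the next is a power of `T` which moves any union of levels of
the `j`-th tower only a little. -/
theorem IsCuttingAndStacking.measureReal_symmDiff_levels_le [IsProbabilityMeasure μ]
    (h : IsCuttingAndStacking μ T h₁ r s E C) (hT : MeasurePreserving T μ μ) (hr : ∀ j, 2 ≤ r j)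
    {j m w : ℕ}
    (hw : ∀ n, n + 1 < blockCount r j m →
      blockStart h₁ r s j m (n + 1) = blockStart h₁ r s j m n + w)
    {F : Finset ℕ} (hF : ∀ k ∈ F, k < H j) :
    μ.real ({x | ∃ k ∈ F, -(k : ℤ) - w ∈ visits T E x j} ∆
      {x | ∃ k ∈ F, -(k : ℤ) ∈ visits T E x j}) ≤ 2 / 2 ^ m := by
  set L : ℕ := blockStart h₁ r s j m (blockCount r j m - 1) with hL
  -- only the last copy is moved out of the set and only the first copy is not covered
  have h1 : ({x | ∃ k ∈ F, -(k : ℤ) - w ∈ visits T E x j} ∆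
      {x | ∃ k ∈ F, -(k : ℤ) ∈ visits T E x j}) ⊆
      (⋃ k ∈ Finset.range (H j), {x | -(k : ℤ) - w - L ∈ visits T E x (j + m)}) ∪
        ⋃ k ∈ Finset.range (H j), {x | -(k : ℤ) ∈ visits T E x (j + m)} := by
    rintro x (⟨⟨a, ha, hax⟩, hx⟩ | ⟨⟨a, ha, hax⟩, hx⟩)
    · left
      simp only [Set.mem_iUnion, Finset.mem_range, exists_prop]
      refine ⟨a, hF a ha, ?_⟩
      obtain ⟨n, hn, hnx⟩ := ((h.isHierarchy x).mem_iff_blockStart hr j m _).mp hax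
      by_cases hn' : n + 1 < blockCount r j m
      · refine absurd ⟨a, ha, ?_⟩ hx
        refine ((h.isHierarchy x).mem_iff_blockStart hr j m _).mpr ⟨n + 1, hn', ?_⟩
        rw [hw n hn']
        convert hnx using 1
        push_cast
        ring
      · rwa [Set.mem_ofPred_eq, hL, show blockCount r j m - 1 = n by omega]
    · right
      simp only [Set.mem_iUnion, Finset.mem_range, exists_prop]
      refine ⟨a, hF a ha, ?_⟩
      obtain ⟨n, hn, hnx⟩ := ((h.isHierarchy x).mem_iff_blockStart hr j m _).mp hax
      cases n with
      | zero => simpa [blockStart_zero] using hnx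
      | succ n =>
        refine absurd ⟨a, ha, ?_⟩ hx
        refine ((h.isHierarchy x).mem_iff_blockStart hr j m _).mpr ⟨n, by omega, ?_⟩
        rw [hw n hn] at hnx
        convert hnx using 1
        push_cast
        ring
  have h2 := measureReal_biUnion_finset_le (μ := μ) (Finset.range (H j))
    fun k => {x | -(k : ℤ) - w - L ∈ visits T E x (j + m)}
  have h3 := measureReal_biUnion_finset_le (μ := μ) (Finset.range (H j))
    fun k => {x | -(k : ℤ) ∈ visits T E x (j + m)}
  simp only [h.measureReal_mem_visits hT, Finset.sum_const, Finset.card_range, nsmul_eq_mul]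
    at h2 h3
  have h4 := h.towerHeight_mul_measureReal_add_le hT hr j m
  refine (measureReal_mono h1).trans ((measureReal_union_le _ _).trans ?_)
  calc _ ≤ 1 / 2 ^ m + 1 / (2 : ℝ) ^ m := add_le_add (h2.trans h4) (h3.trans h4)
    _ = _ := by ring

/-- For a non-rigid construction, some `m` is such that the gaps between the copies of the `j`-th
tower in the tower number `j + m` are not all equal, for all large `j`. -/
theorem IsCuttingAndStacking.exists_isUnequalGap [IsProbabilityMeasure μ]
    (h : IsCuttingAndStacking μ T h₁ r s E C) (hT : MeasurePreserving T μ μ) (hr : ∀ j, 2 ≤ r j)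
    {S : ℕ} (hS : ∀ j, ∀ i < r j, s j i ≤ S) (hrigid : ¬ IsRigid μ T) :
    ∃ m, ∀ j ≥ m, ∃ n, IsUnequalGap h₁ r s j m n := by
  by_contra! hcon
  choose J hJ hgap using hcon
  refine hrigid ⟨fun k => blockStart h₁ r s (J (k + 1)) (k + 1) 1, ?_, fun A hA => ?_⟩
  · refine tendsto_atTop_mono (fun k => ?_) tendsto_id
    have h1 : 0 + 1 < blockCount r (J (k + 1)) (k + 1) :=
      (one_lt_pow₀ one_lt_two k.succ_ne_zero).trans_le (two_pow_le_blockCount hr _ _)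
    obtain ⟨g, -, hg⟩ := blockStart_succ (h₁ := h₁) hr hS h1
    rw [blockStart_zero, zero_add, zero_add] at hg
    have h2 := two_pow_le_towerHeight (h₁ := h₁) (s := s) hr (J (k + 1))
    have h3 := hJ (k + 1)
    have h4 := (J (k + 1)).lt_two_pow_self
    simp only [id]
    omega
  suffices hlim : Tendsto (fun k => μ.real ((T^[blockStart h₁ r s (J (k + 1)) (k + 1) 1] '' A) ∆ A))
      atTop (𝓝 0) by
    refine (ENNReal.tendsto_toReal_iff (fun _ => measure_ne_top _ _) ENNReal.zero_ne_top).mp ?_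
    simpa [Measure.real] using hlim
  rw [Metric.tendsto_atTop']
  intro ε hε
  obtain ⟨K, hK⟩ := eventually_atTop.mp (h.eventually_exists_levels hA (ε := ε / 4) (by linarith))
  have hpow : Tendsto (fun k : ℕ => 2 / (2 : ℝ) ^ (k + 1)) atTop (𝓝 0) :=
    ((tendsto_pow_atTop_atTop_of_one_lt (one_lt_two : (1 : ℝ) < 2)).comp
      (tendsto_add_atTop_nat 1)).const_div_atTop 2
  obtain ⟨K', hK'⟩ := eventually_atTop.mp (hpow.eventually_lt_const (by linarith : 0 < ε / 2))
  refine ⟨max K K', fun k hk => ?_⟩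
  -- the start of the second copy, which is the common distance between consecutive copies
  set w := blockStart h₁ r s (J (k + 1)) (k + 1) 1 with hw
  have hkK : k ≥ K := (le_max_left _ _).trans hk.le
  have hconst : ∀ n, n + 1 < blockCount r (J (k + 1)) (k + 1) →
      blockStart h₁ r s (J (k + 1)) (k + 1) (n + 1) =
        blockStart h₁ r s (J (k + 1)) (k + 1) n + w := by
    intro n
    induction n with
    | zero => intro _; rw [blockStart_zero, zero_add, zero_add]
    | succ n ih =>
      intro hn
      have h1 := ih (by omega)
      have h2 := hgap (k + 1) n
      simp only [IsUnequalGap, not_and, not_not] at h2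
      have h3 := h2 hn
      change blockStart h₁ r s (J (k + 1)) (k + 1) (n + 2) = _
      omega
  obtain ⟨F, hF, hFA⟩ := hK (J (k + 1)) (by have := hJ (k + 1); omega)
  have h1 := h.measureReal_symmDiff_levels_le hT hr hconst hF
  have h2 := hK' k ((le_max_right _ _).trans hk.le)
  rw [Real.dist_0_eq_abs, abs_of_nonneg measureReal_nonneg, iterate_image_eq]
  set B := {x | ∃ k_1 ∈ F, -(k_1 : ℤ) ∈ visits T E x (J (k + 1))} with hB
  have hBm : MeasurableSet B := h.measurableSet_levels _ _
  have hB' : {x | ∃ k_1 ∈ F, -(k_1 : ℤ) - w ∈ visits T E x (J (k + 1))} =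
      {x | power T (-w) x ∈ B} := by
    ext x
    simp only [hB, Set.mem_ofPred_eq, mem_visits_power, ← sub_eq_add_neg]
  rw [hB'] at h1
  have h3 : {x | power T (-w) x ∈ A} ∆ A ⊆ {x | power T (-w) x ∈ A ∆ B} ∪
      ({x | power T (-w) x ∈ B} ∆ B ∪ A ∆ B) := by
    intro x
    simp only [Set.mem_symmDiff, Set.mem_union, Set.mem_ofPred_eq]
    tauto
  have h4 := measureReal_power_preimage hT (-w) (hA.symmDiff hBm)
  have h5 := (measureReal_mono (μ := μ) h3).trans ((measureReal_union_le _ _).trans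
    (add_le_add_right (measureReal_union_le _ _) _))
  linarith

end Orbits

/-! ### Drift of the offsets -/

section Counting

variable {h₁ : ℕ} {r : ℕ → ℕ} {s : ℕ → ℕ → ℕ} {P Q : ℕ → Set ℤ}

local notation "H" => towerHeight h₁ r s

open Classical in
/-- Let two pairs of overlapping `j`-blocks have offsets that differ by `e`. The translation of the
first overlap to the blocks of the second pair shows that the simultaneous visits of `P` and of `Q`
delayed by `c` are as frequent as those with the delay `c + e`. If this happens for
infinitely many `j`, then the limit frequencies `κ` and `κ'` are equal. -/
theorem frequency_eq_of_frequently_drift (hP : IsHierarchy h₁ r s P) (hQ : IsHierarchy h₁ r s Q)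
    (hr : ∀ j, 2 ≤ r j) {K D : ℕ} (hD : 0 < D) {e : ℤ}
    (hdrift : ∃ᶠ j in atTop, ∃ p ∈ P j, ∃ q ∈ P j, ∃ p' ∈ Q j, ∃ q' ∈ Q j, |p| ≤ K * H j ∧
      |q| ≤ K * H j ∧ D * |p' - p| ≤ (D - 1) * H j ∧ (p' - p) - (q' - q) = e) {i : ℕ} {c : ℤ}
    {κ κ' : ℝ}
    (hκ : ∀ ε > 0, ∃ b : ℝ, ∀ (a : ℤ) (n : ℕ),
      |∑ k ∈ Finset.range n, (if a + k ∈ P i ∧ a + k - c ∈ Q i then (1 : ℝ) else 0) - n * κ| ≤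
        ε * (|(a : ℝ)| + |((a + n : ℤ) : ℝ)|) + b)
    (hκ' : ∀ ε > 0, ∃ b : ℝ, ∀ (a : ℤ) (n : ℕ),
      |∑ k ∈ Finset.range n, (if a + k ∈ P i ∧ a + k - (c + e) ∈ Q i then (1 : ℝ) else 0) -
        n * κ'| ≤ ε * (|(a : ℝ)| + |((a + n : ℤ) : ℝ)|) + b) : κ = κ' := by
  by_contra hne
  have hΔ : 0 < |κ - κ'| := abs_pos.mpr (sub_ne_zero.mpr hne)
  obtain ⟨Δ, hΔdef⟩ : ∃ Δ, Δ = |κ - κ'| := ⟨_, rfl⟩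
  rw [← hΔdef] at hΔ
  have hD' : (0 : ℝ) < D := by exact_mod_cast hD
  have hK' : (0 : ℝ) < (K : ℝ) + 1 := by positivity
  obtain ⟨ε, hεdef⟩ : ∃ ε, ε = Δ / (8 * D * (K + 1)) := ⟨_, rfl⟩
  have hε : 0 < ε := hεdef ▸ by positivity
  obtain ⟨b, hb⟩ := hκ ε hε
  obtain ⟨b', hb'⟩ := hκ' ε hε
  have hlarge : ∀ᶠ j in atTop, 2 * (D * (|(c : ℝ)| * Δ + b + b') / Δ) < H j :=
    (tendsto_natCast_atTop_atTop.comp (tendsto_towerHeight hr)).eventually_gt_atTop _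
  have hlarge' : ∀ᶠ j in atTop, D * c.natAbs ≤ H j :=
    (tendsto_towerHeight hr).eventually_ge_atTop _
  obtain ⟨j, ⟨p, hp, q, hq, p', hp', q', hq', hpK, hqK, hpp, he⟩, hj, hj', hij⟩ :=
    (hdrift.and_eventually (hlarge.and (hlarge'.and (eventually_ge_atTop i)))).exists
  obtain ⟨d, hd⟩ : ∃ d, d = p' - p := ⟨_, rfl⟩
  rw [← hd] at hpp
  have hjc : (D : ℤ) * |c| ≤ H j := by
    rw [Int.abs_eq_natAbs]
    exact_mod_cast hj'
  have habs : |d + c| ≤ |d| + |c| := abs_add_le d c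
  have hdc : |d + c| ≤ H j := by
    have h1 : (D : ℤ) * |d + c| ≤ D * H j := by
      calc (D : ℤ) * |d + c| ≤ D * (|d| + |c|) := by gcongr
        _ ≤ D * H j := by linarith
    exact le_of_mul_le_mul_left h1 (by exact_mod_cast hD)
  rw [abs_le] at hdc
  -- the overlap of the first pair of blocks, relative to the start of its block of `P`
  obtain ⟨lo, hlo⟩ : ∃ lo : ℤ, lo = max 0 (d + c) := ⟨_, rfl⟩
  obtain ⟨n, hn⟩ : ∃ n : ℕ, (n : ℤ) = H j - |d + c| :=
    ⟨(H j - |d + c|).toNat, Int.toNat_of_nonneg (sub_nonneg.mpr (abs_le.mpr hdc))⟩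
  have hsum : ∑ k ∈ Finset.range n,
        (if p + lo + k ∈ P i ∧ p + lo + k - c ∈ Q i then (1 : ℝ) else 0) =
      ∑ k ∈ Finset.range n,
        (if q + lo + k ∈ P i ∧ q + lo + k - (c + e) ∈ Q i then (1 : ℝ) else 0) := by
    refine Finset.sum_congr rfl fun k hk => ?_
    have hk := Finset.mem_range.mp hk
    have hbound : 0 ≤ lo + k ∧ lo + k < H j ∧ 0 ≤ lo + k - c - d ∧ lo + k - c - d < H j := by
      rcases le_total 0 (d + c) with h0 | h0
      · rw [max_eq_right h0] at hlo
        rw [abs_of_nonneg h0] at hn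
        omega
      · rw [max_eq_left h0] at hlo
        rw [abs_of_nonpos h0] at hn
        omega
    obtain ⟨b1, b2, b3, b4⟩ := hbound
    have h1 := hP.mem_iff_add_mem hP hr hij hp hq b1 b2
    have h2 := hQ.mem_iff_add_mem hQ hr hij hp' hq' b3 b4
    rw [show p + (lo + k) = p + lo + k by ring, show q + (lo + k) = q + lo + k by ring] at h1
    rw [show p' + (lo + k - c - d) = p + lo + k - c by rw [hd]; ring,
      show q' + (lo + k - c - d) = q + lo + k - (c + e) by rw [← he, hd]; ring] at h2
    rw [h1, h2]
  have hends : ∀ t : ℤ, |t| ≤ K * H j →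
      |((t + lo : ℤ) : ℝ)| + |((t + lo + n : ℤ) : ℝ)| ≤ 2 * ((K + 1) * H j) := by
    intro t ht
    have hbound : 0 ≤ lo ∧ lo + n ≤ H j := by
      rcases le_total 0 (d + c) with h0 | h0
      · rw [max_eq_right h0] at hlo
        rw [abs_of_nonneg h0] at hn
        omega
      · rw [max_eq_left h0] at hlo
        rw [abs_of_nonpos h0] at hn
        omega
    rw [abs_le] at ht
    have h1 : |t + lo| ≤ (K + 1) * H j := by rw [abs_le]; constructor <;> linarith
    have h2 : |t + lo + n| ≤ (K + 1) * H j := by rw [abs_le]; constructor <;> linarith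
    have h1' : ((|t + lo| : ℤ) : ℝ) ≤ (((K + 1) * H j : ℤ) : ℝ) := Int.cast_le.mpr h1
    have h2' : ((|t + lo + n| : ℤ) : ℝ) ≤ (((K + 1) * H j : ℤ) : ℝ) := Int.cast_le.mpr h2
    push_cast at h1' h2' ⊢
    linarith
  have h1 := hb (p + lo) n
  have h2 := hb' (q + lo) n
  rw [hsum] at h1
  have h3 := hends p hpK
  have h4 := hends q hqK
  have h5 : n * Δ ≤ 4 * (ε * ((K + 1) * H j)) + b + b' := by
    have e1 : ε * (|((p + lo : ℤ) : ℝ)| + |((p + lo + n : ℤ) : ℝ)|) ≤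
        ε * (2 * ((K + 1) * H j)) := by gcongr
    have e2 : ε * (|((q + lo : ℤ) : ℝ)| + |((q + lo + n : ℤ) : ℝ)|) ≤
        ε * (2 * ((K + 1) * H j)) := by gcongr
    have e3 : n * Δ = |n * κ - n * κ'| := by
      rw [hΔdef, ← mul_sub, abs_mul, Nat.abs_cast]
    rw [e3]
    rw [abs_sub_comm] at h1
    refine (abs_sub_le _ _ _).trans ((add_le_add h1 h2).trans ?_)
    linarith
  have h6 : ε * ((K + 1) * H j) = Δ * H j / (8 * D) := by
    rw [hεdef]
    field_simp
  have h7 : (H j : ℝ) - D * |(c : ℝ)| ≤ D * n := by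
    have h8 : (H j : ℤ) - D * |c| ≤ D * n := by
      rw [hn]
      have : (D : ℤ) * |d + c| ≤ D * (|d| + |c|) := by gcongr
      linarith
    have h9 : (((H j : ℤ) - D * |c| : ℤ) : ℝ) ≤ ((D * n : ℤ) : ℝ) := Int.cast_le.mpr h8
    push_cast at h9
    exact h9
  rw [← mul_div_assoc, div_lt_iff₀ hΔ] at hj
  have h8 : (D : ℝ) * (n * Δ) ≤ D * (4 * (Δ * H j / (8 * D)) + b + b') := by
    rw [← h6]; gcongr
  have h9 : (D : ℝ) * (4 * (Δ * H j / (8 * D)) + b + b') = Δ * H j / 2 + D * (b + b') := by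
    field_simp
    ring
  have h10 : ((H j : ℝ) - D * |(c : ℝ)|) * Δ ≤ D * n * Δ := by gcongr
  nlinarith

end Counting

section Joinings

variable {X : Type*} [MeasurableSpace X] {μ : Measure X} {T : X ≃ᵐ X}
  {h₁ : ℕ} {r : ℕ → ℕ} {s : ℕ → ℕ → ℕ} {E : ℕ → Set X} {C : ℕ → ℕ → Set X} {ν : Measure (X × X)}

local notation "H" => towerHeight h₁ r s

theorem power_prodCongr (n : ℤ) (z : X × X) :
    power (T.prodCongr T) n z = (power T n z.1, power T n z.2) := by
  have h1 : ∀ z : X × X, (T.prodCongr T) z = Prod.map T T z := fun _ => rfl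
  have h2 : ∀ z : X × X, (T.prodCongr T).symm z = Prod.map T.symm T.symm z := fun _ => rfl
  obtain ⟨k, rfl | rfl⟩ := n.eq_nat_or_neg
  · simp only [power_natCast, funext h1, Prod.map_iterate]
    rfl
  · simp only [power_neg_natCast, funext h2, Prod.map_iterate]
    rfl

namespace IsSelfJoining

theorem isProbabilityMeasure [IsProbabilityMeasure μ] (hν : IsSelfJoining μ T ν) :
    IsProbabilityMeasure ν := by
  constructor
  have h : ν.map Prod.fst Set.univ = 1 := by rw [hν.map_fst]; exact measure_univ
  rwa [Measure.map_apply measurable_fst MeasurableSet.univ] at h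

theorem measurePreserving_fst (hν : IsSelfJoining μ T ν) : MeasurePreserving Prod.fst ν μ :=
  ⟨measurable_fst, hν.map_fst⟩

theorem measurePreserving_snd (hν : IsSelfJoining μ T ν) : MeasurePreserving Prod.snd ν μ :=
  ⟨measurable_snd, hν.map_snd⟩

theorem measureReal_fst (hν : IsSelfJoining μ T ν) {A : Set X} (hA : MeasurableSet A) :
    ν.real {z | z.1 ∈ A} = μ.real A :=
  hν.measurePreserving_fst.measureReal_preimage hA.nullMeasurableSet

theorem measureReal_snd (hν : IsSelfJoining μ T ν) {A : Set X} (hA : MeasurableSet A) :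
    ν.real {z | z.2 ∈ A} = μ.real A :=
  hν.measurePreserving_snd.measureReal_preimage hA.nullMeasurableSet

/-- A self-joining which is invariant under the action of an ergodic transformation on the second
coordinate is the product measure. -/
theorem eq_prod_of_invariant [IsProbabilityMeasure μ] (hν : IsSelfJoining μ T ν) {f : X → X}
    (hf : Ergodic f μ)
    (hinv : ∀ A B, MeasurableSet A → MeasurableSet B →
      ν {z | z.1 ∈ A ∧ f z.2 ∈ B} = ν (A ×ˢ B)) : ν = μ.prod μ := by
  have := hν.isProbabilityMeasure
  refine (Measure.prod_eq fun A B hA hB => ?_).symm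
  -- the second marginal of the restriction of `ν` to `A × X`
  let ρ := (ν.restrict (Prod.fst ⁻¹' A)).map Prod.snd
  have hρ : ∀ B, MeasurableSet B → ρ B = ν (A ×ˢ B) := by
    intro B hB
    rw [Measure.map_apply measurable_snd hB, Measure.restrict_apply (measurable_snd hB),
      Set.inter_comm, Set.prod_eq]
  have hac : ρ ≪ μ := by
    refine Measure.AbsolutelyContinuous.mk fun B hB h0 => ?_
    rw [hρ B hB]
    refine measure_mono_null (fun z hz => hz.2)
      (show ν (Prod.snd ⁻¹' B) = 0 by
        rwa [hν.measurePreserving_snd.measure_preimage hB.nullMeasurableSet])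
  have hmp : MeasurePreserving f ρ ρ := by
    refine ⟨hf.measurable, Measure.ext fun B hB => ?_⟩
    rw [Measure.map_apply hf.measurable hB, hρ _ (hf.measurable hB), hρ B hB, ← hinv A B hA hB]
    rfl
  have : IsFiniteMeasure ρ := ⟨by rw [hρ _ MeasurableSet.univ]; exact measure_lt_top _ _⟩
  obtain ⟨c, hc⟩ := hf.eq_smul_of_absolutelyContinuous hmp hac
  have h1 : ρ Set.univ = μ A := by
    rw [hρ _ MeasurableSet.univ, Set.prod_univ, hν.measurePreserving_fst.measure_preimage
      hA.nullMeasurableSet]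
  rw [hc, Measure.smul_apply, measure_univ, smul_eq_mul, mul_one] at h1
  rw [← hρ B hB, hc, h1, Measure.smul_apply, smul_eq_mul]

theorem measureReal_visits [IsProbabilityMeasure μ] (hν : IsSelfJoining μ T ν)
    (h : IsCuttingAndStacking μ T h₁ r s E C) (j : ℕ) (a b : ℤ) :
    ν.real {z | -a ∈ visits T E z.1 j ∧ -b ∈ visits T E z.2 j} =
      ν.real {z | 0 ∈ visits T E z.1 j ∧ -(b - a) ∈ visits T E z.2 j} := by
  have hmp : MeasurePreserving (T.prodCongr T) ν ν := hν.invariant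
  have hm : MeasurableSet {z : X × X | 0 ∈ visits T E z.1 j ∧ -(b - a) ∈ visits T E z.2 j} :=
    (measurable_fst (h.measurableSet_mem_visits j 0)).inter
      (measurable_snd (h.measurableSet_mem_visits j _))
  rw [← measureReal_power_preimage hmp (-a) hm]
  congr 1
  ext z
  simp only [Set.mem_ofPred_eq, power_prodCongr, mem_visits_power]
  rw [zero_add, show -(b - a) + -a = -b by ring]

/-- Invariance of the joining on pairs of levels implies invariance on measurable rectangles. -/
theorem measure_power_snd_eq [IsProbabilityMeasure μ] (hν : IsSelfJoining μ T ν)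
    (h : IsCuttingAndStacking μ T h₁ r s E C) (hT : MeasurePreserving T μ μ) {e : ℤ}
    (he : ∀ (i : ℕ) (c : ℤ), ν.real {z | 0 ∈ visits T E z.1 i ∧ -c ∈ visits T E z.2 i} =
      ν.real {z | 0 ∈ visits T E z.1 i ∧ -(c + e) ∈ visits T E z.2 i}) {A B : Set X}
    (hA : MeasurableSet A) (hB : MeasurableSet B) :
    ν {z | z.1 ∈ A ∧ power T (-e) z.2 ∈ B} = ν (A ×ˢ B) := by
  have := hν.isProbabilityMeasure
  -- unions of levels are disjoint unions of pairs of levels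
  have hlev : ∀ (j : ℕ) (F G : Finset ℕ) (t : ℤ), (∀ k ∈ F, k < H j) → (∀ k ∈ G, k < H j) →
      ν.real {z | (∃ k ∈ F, -(k : ℤ) ∈ visits T E z.1 j) ∧
        ∃ k ∈ G, -(k : ℤ) ∈ visits T E (power T (-t) z.2) j} =
      ∑ k ∈ F ×ˢ G, ν.real {z | 0 ∈ visits T E z.1 j ∧
        -((k.2 : ℤ) - k.1 + t) ∈ visits T E z.2 j} := by
    intro j F G t hF hG
    have hset : {z : X × X | (∃ k ∈ F, -(k : ℤ) ∈ visits T E z.1 j) ∧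
        ∃ k ∈ G, -(k : ℤ) ∈ visits T E (power T (-t) z.2) j} =
        ⋃ k ∈ F ×ˢ G, {z | -(k.1 : ℤ) ∈ visits T E z.1 j ∧
          -((k.2 : ℤ) + t) ∈ visits T E z.2 j} := by
      ext z
      simp only [Set.mem_ofPred_eq, Set.mem_iUnion, Finset.mem_product, exists_prop, Prod.exists,
        mem_visits_power, neg_add]
      constructor
      · rintro ⟨⟨a, ha, hax⟩, b, hb, hbx⟩
        exact ⟨a, b, ⟨ha, hb⟩, hax, hbx⟩
      · rintro ⟨a, b, ⟨ha, hb⟩, hax, hbx⟩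
        exact ⟨⟨a, ha, hax⟩, b, hb, hbx⟩
    rw [hset, measureReal_biUnion_finset]
    · refine Finset.sum_congr rfl fun k _ => ?_
      rw [hν.measureReal_visits h]
      congr! 6
      ring
    · rintro ⟨a, b⟩ hab ⟨a', b'⟩ hab' hne
      refine Set.disjoint_left.mpr fun z hz hz' => hne ?_
      obtain ⟨ha, hb⟩ := Finset.mem_product.mp hab
      obtain ⟨ha', hb'⟩ := Finset.mem_product.mp hab'
      have ha := hF _ ha
      have hb := hG _ hb
      have ha' := hF _ ha'
      have hb' := hG _ hb'
      dsimp only at ha hb ha' hb'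
      have h1 := (h.isHierarchy z.1).eq_of_abs_lt j _ hz.1 _ hz'.1
        (by rw [abs_lt]; constructor <;> dsimp only <;> omega)
      have h2 := (h.isHierarchy z.2).eq_of_abs_lt j _ hz.2 _ hz'.2
        (by rw [abs_lt]; constructor <;> dsimp only <;> omega)
      dsimp only at h1 h2
      ext <;> dsimp only <;> omega
    · intro k _
      exact (measurable_fst (h.measurableSet_mem_visits j _)).inter
        (measurable_snd (h.measurableSet_mem_visits j _))
  -- the error of an approximation by levels
  have happ : ∀ (t : ℤ) (A' B' : Set X), MeasurableSet A' → MeasurableSet B' →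
      |ν.real {z | z.1 ∈ A ∧ power T (-t) z.2 ∈ B} -
        ν.real {z | z.1 ∈ A' ∧ power T (-t) z.2 ∈ B'}| ≤ μ.real (A ∆ A') + μ.real (B ∆ B') := by
    intro t A' B' hA' hB'
    have h1 : ν.real {z | z.1 ∈ A ∆ A'} = μ.real (A ∆ A') := hν.measureReal_fst (hA.symmDiff hA')
    have h2 : ν.real {z | power T (-t) z.2 ∈ B ∆ B'} = μ.real (B ∆ B') :=
      (hν.measureReal_snd (measurable_power T _ (hB.symmDiff hB'))).trans
        (measureReal_power_preimage hT (-t) (hB.symmDiff hB'))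
    have hle : ∀ U V : Set (X × X),
        U ⊆ V ∪ ({z | z.1 ∈ A ∆ A'} ∪ {z | power T (-t) z.2 ∈ B ∆ B'}) →
        ν.real U - ν.real V ≤ μ.real (A ∆ A') + μ.real (B ∆ B') := by
      intro U V hUV
      rw [← h1, ← h2, sub_le_iff_le_add']
      exact (measureReal_mono hUV).trans ((measureReal_union_le _ _).trans
        (add_le_add_right (measureReal_union_le _ _) _))
    rw [abs_le, neg_le, neg_sub]
    constructor
    all_goals
      refine hle _ _ fun z => ?_
      simp only [Set.mem_symmDiff, Set.mem_union, Set.mem_ofPred_eq]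
      tauto
  have hreal : ν.real {z | z.1 ∈ A ∧ power T (-e) z.2 ∈ B} =
      ν.real {z | z.1 ∈ A ∧ power T (-0) z.2 ∈ B} := by
    refine eq_of_forall_dist_le fun ε hε => ?_
    obtain ⟨j, ⟨F, hF, hFA⟩, G, hG, hGB⟩ :=
      ((h.eventually_exists_levels hA (ε := ε / 4) (by linarith)).and
        (h.eventually_exists_levels hB (ε := ε / 4) (by linarith))).exists
    have h1 := happ e _ _ (h.measurableSet_levels j F) (h.measurableSet_levels j G)
    have h2 := happ 0 _ _ (h.measurableSet_levels j F) (h.measurableSet_levels j G)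
    have h3 : ν.real {z | z.1 ∈ {x | ∃ k ∈ F, -(k : ℤ) ∈ visits T E x j} ∧
          power T (-e) z.2 ∈ {x | ∃ k ∈ G, -(k : ℤ) ∈ visits T E x j}} =
        ν.real {z | z.1 ∈ {x | ∃ k ∈ F, -(k : ℤ) ∈ visits T E x j} ∧
          power T (-0) z.2 ∈ {x | ∃ k ∈ G, -(k : ℤ) ∈ visits T E x j}} := by
      simp only [Set.mem_ofPred_eq]
      rw [hlev j F G e hF hG, hlev j F G 0 hF hG]
      exact Finset.sum_congr rfl fun k _ => by rw [← he, add_zero]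
    rw [h3] at h1
    rw [abs_le] at h1 h2
    rw [Real.dist_eq, abs_le]
    constructor <;> linarith
  have hset : {z : X × X | z.1 ∈ A ∧ power T (-0) z.2 ∈ B} = A ×ˢ B := by
    ext z
    rw [Set.mem_ofPred_eq, neg_zero, power_zero, Set.mem_prod]
  rw [hset] at hreal
  exact (measureReal_eq_measureReal_iff).mp hreal

open Classical in
/-- For an ergodic joining other than the product measure, the offsets of overlapping blocks do not
drift. Otherwise, by Birkhoff's theorem, the joining would be invariant under the action of some
power of `T` on the second coordinate. -/
theorem ae_eventually_noDrift [IsProbabilityMeasure μ] (hν : IsSelfJoining μ T ν)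
    (hergν : Ergodic (Prod.map T T) ν) (h : IsCuttingAndStacking μ T h₁ r s E C)
    (hT : MeasurePreserving T μ μ) (hr : ∀ j, 2 ≤ r j) (herg : IsTotallyErgodic μ T)
    (hne : ν ≠ μ.prod μ) (K D M : ℕ) (hD : 0 < D) :
    ∀ᵐ z ∂ν, ∀ᶠ j in atTop, NoDrift h₁ r s (visits T E z.1) (visits T E z.2) K D M j := by
  have := hν.isProbabilityMeasure
  have herg' : Ergodic (T.prodCongr T) ν := hergν
  let G : ℕ → ℤ → Set (X × X) := fun i c => {z | 0 ∈ visits T E z.1 i ∧ -c ∈ visits T E z.2 i}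
  have hGm : ∀ i c, MeasurableSet (G i c) := fun i c =>
    (measurable_fst (h.measurableSet_mem_visits i 0)).inter
      (measurable_snd (h.measurableSet_mem_visits i _))
  -- almost every pair is generic for all the correlations between levels
  have hB : ∀ᵐ z ∂ν, ∀ (i : ℕ) (c : ℤ), ∀ ε > 0, ∃ b : ℝ, ∀ (a : ℤ) (n : ℕ),
      |∑ k ∈ Finset.range n, (if a + k ∈ visits T E z.1 i ∧ a + k - c ∈ visits T E z.2 i
        then (1 : ℝ) else 0) - n * ν.real (G i c)| ≤
        ε * (|(a : ℝ)| + |((a + n : ℤ) : ℝ)|) + b := by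
    rw [ae_all_iff]
    intro i
    rw [ae_all_iff]
    intro c
    have hB := ae_abs_interval_sum_sub_le herg' (g := (G i c).indicator 1)
      (measurable_one.indicator (hGm i c)) ((integrable_const 1).indicator (hGm i c))
    rw [integral_indicator_one (hGm i c)] at hB
    have hval : ∀ (z : X × X) (t : ℤ), (G i c).indicator (1 : X × X → ℝ)
        (power (T.prodCongr T) t z) =
        if t ∈ visits T E z.1 i ∧ t - c ∈ visits T E z.2 i then 1 else 0 := by
      intro z t
      rw [Set.indicator_apply]
      simp only [G, Set.mem_ofPred_eq, power_prodCongr, mem_visits_power, zero_add,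
        neg_add_eq_sub, Pi.one_apply]
    simpa only [hval] using hB
  filter_upwards [hB] with z hz
  by_contra hno
  have hfreq : ∃ᶠ j in atTop, ∃ e ∈ Set.Icc (-(M : ℤ)) M \ {0},
      ∃ p ∈ visits T E z.1 j, ∃ q ∈ visits T E z.1 j, ∃ p' ∈ visits T E z.2 j,
      ∃ q' ∈ visits T E z.2 j, |p| ≤ K * H j ∧ |q| ≤ K * H j ∧
      D * |p' - p| ≤ (D - 1) * H j ∧ (p' - p) - (q' - q) = e := by
    refine (not_eventually.mp hno).mono fun j hj => ?_
    unfold NoDrift at hj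
    push Not at hj
    obtain ⟨p, hp, q, hq, p', hp', q', hq', h1, h2, h3, h4, h5⟩ := hj
    exact ⟨_, ⟨Set.mem_Icc.mpr (abs_le.mp h4), fun h0 => h5 (sub_eq_zero.mp h0)⟩, p, hp, q, hq,
      p', hp', q', hq', h1, h2, h3, rfl⟩
  obtain ⟨e, he0, hfr⟩ : ∃ e : ℤ, e ≠ 0 ∧ ∃ᶠ j in atTop,
      ∃ p ∈ visits T E z.1 j, ∃ q ∈ visits T E z.1 j, ∃ p' ∈ visits T E z.2 j,
      ∃ q' ∈ visits T E z.2 j, |p| ≤ K * H j ∧ |q| ≤ K * H j ∧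
      D * |p' - p| ≤ (D - 1) * H j ∧ (p' - p) - (q' - q) = e := by
    by_contra hcon
    refine hfreq ?_
    filter_upwards [((Set.finite_Icc (-(M : ℤ)) M).sdiff (t := {0})).eventually_all.mpr
      fun e he => not_frequently.mp (fun hf => hcon ⟨e, he.2, hf⟩)] with j hj
    rintro ⟨e, he, hx⟩
    exact hj e he hx
  refine hne (hν.eq_prod_of_invariant (herg (-e) (neg_ne_zero.mpr he0)) fun A B hA hB =>
    hν.measure_power_snd_eq h hT (fun i c => ?_) hA hB)
  exact frequency_eq_of_frequently_drift (h.isHierarchy z.1) (h.isHierarchy z.2) hr hD hfr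
    (hz i c) (hz i (c + e))

end IsSelfJoining

end Joinings

/-! ### Central times and the conclusion -/

section Conclusion

variable {X : Type*} [MeasurableSpace X] {μ : Measure X} {T : X ≃ᵐ X}
  {h₁ : ℕ} {r : ℕ → ℕ} {s : ℕ → ℕ → ℕ} {E : ℕ → Set X} {C : ℕ → ℕ → Set X} {ν : Measure (X × X)}

local notation "H" => towerHeight h₁ r s

/-- Sets whose measures are bounded below cannot be eventually avoided by almost every point. -/
theorem not_ae_eventually_notMem {Ω : Type*} [MeasurableSpace Ω] {ν : Measure Ω} [IsFiniteMeasure ν]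
    {A : ℕ → Set Ω} (hA : ∀ j, MeasurableSet (A j)) {c : ℝ} (hc : 0 < c)
    (hle : ∀ᶠ j in atTop, c ≤ ν.real (A j)) : ¬ ∀ᵐ z ∂ν, ∀ᶠ j in atTop, z ∉ A j := by
  intro h
  have h1 : Tendsto (fun j => ν (A j)) atTop (𝓝 (ν ∅)) := by
    refine tendsto_measure_of_ae_tendsto_indicator_of_isFiniteMeasure atTop
      MeasurableSet.empty hA ?_
    filter_upwards [h] with z hz
    filter_upwards [hz] with j hj
    simp [hj]
  have h2 : Tendsto (fun j => ν.real (A j)) atTop (𝓝 0) := by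
    have h2 := (ENNReal.tendsto_toReal (measure_ne_top ν ∅)).comp h1
    rwa [measure_empty, ENNReal.toReal_zero] at h2
  exact absurd (ge_of_tendsto h2 hle) (not_le.mpr hc)

/-- The points that lie in a level of the `n`-th copy of the `j`-th tower in the tower number
`j + m`. -/
def copySet (T : X ≃ᵐ X) (h₁ : ℕ) (r : ℕ → ℕ) (s : ℕ → ℕ → ℕ) (E : ℕ → Set X)
    (j m n : ℕ) : Set X :=
  {x | ∃ a < towerHeight h₁ r s j, -((blockStart h₁ r s j m n : ℤ) + a) ∈ visits T E x (j + m)}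

namespace IsCuttingAndStacking

theorem copySet_eq (j m n : ℕ) : copySet T h₁ r s E j m n = ⋃ a ∈ Finset.range (H j),
    {x | -((blockStart h₁ r s j m n : ℤ) + a) ∈ visits T E x (j + m)} := by
  ext x
  simp [copySet]

theorem measurableSet_copySet (h : IsCuttingAndStacking μ T h₁ r s E C) (j m n : ℕ) :
    MeasurableSet (copySet T h₁ r s E j m n) := by
  rw [copySet_eq]
  exact Finset.measurableSet_biUnion _ fun k _ => h.measurableSet_mem_visits _ _

theorem measureReal_copySet [IsProbabilityMeasure μ] (h : IsCuttingAndStacking μ T h₁ r s E C)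
    (hT : MeasurePreserving T μ μ) (hr : ∀ j, 2 ≤ r j) (j m n : ℕ) :
    μ.real (copySet T h₁ r s E j m n) = H j * μ.real (E (j + m)) := by
  rw [copySet_eq, measureReal_biUnion_finset]
  · simp [h.measureReal_mem_visits hT]
  · intro a ha b hb hab
    refine Set.disjoint_left.mpr fun x hx hx' => hab ?_
    have ha := Finset.mem_range.mp ha
    have hb := Finset.mem_range.mp hb
    have hH : H j ≤ H (j + m) := towerHeight_mono hr (Nat.le_add_right j m)
    have := (h.isHierarchy x).eq_of_abs_lt (j + m) _ hx _ hx'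
      (by rw [abs_lt]; constructor <;> omega)
    omega
  · exact fun k _ => h.measurableSet_mem_visits _ _

end IsCuttingAndStacking

namespace IsSelfJoining

/-- When `k` is large, the proportion of the bad positions in the tower number `j + k` is small in
comparison with the proportion of a single copy of the `j`-th tower in the tower number `j + m`, so
that in any joining the probability of a central time is bounded below. -/
theorem exists_le_measureReal_central [IsProbabilityMeasure μ] (hν : IsSelfJoining μ T ν)
    (h : IsCuttingAndStacking μ T h₁ r s E C) (hT : MeasurePreserving T μ μ) (hr : ∀ j, 2 ≤ r j)
    {R S : ℕ} (hR : ∀ j, r j ≤ R) (hS : ∀ j, ∀ i < r j, s j i ≤ S) (m : ℕ) (n : ℕ → ℕ) :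
    ∃ k ≥ m, ∃ c > 0, ∀ᶠ j in atTop, c ≤ ν.real {z | z.1 ∈ copySet T h₁ r s E j m (n j) ∧
      z.2 ∈ towerCore T h₁ r s E (j + k) (4 * H j)} := by
  have := hν.isProbabilityMeasure
  obtain ⟨B, hBdef⟩ : ∃ B : ℝ, B = (((R * (S + 1)) ^ m : ℕ) : ℝ) := ⟨_, rfl⟩
  have hB : 0 < B := by
    have hR0 : 0 < R := by have := hr 0; have := hR 0; omega
    rw [hBdef]
    exact_mod_cast pow_pos (Nat.mul_pos hR0 S.succ_pos) m
  obtain ⟨k₀, hk₀⟩ := pow_unbounded_of_one_lt (64 * B) (one_lt_two : (1 : ℝ) < 2)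
  refine ⟨max m k₀, le_max_left _ _, 1 / (4 * B), by positivity, ?_⟩
  set k := max m k₀ with hk
  have hk64 : 64 * B ≤ 2 ^ k :=
    hk₀.le.trans (pow_le_pow_right₀ one_le_two (le_max_right _ _))
  have ht := h.tendsto_measureReal_tower_compl
  have e1 := (ht.comp (tendsto_add_atTop_nat m)).eventually_le_const
    (show (0 : ℝ) < 1 / 2 by norm_num)
  have e2 := (ht.comp (tendsto_add_atTop_nat k)).eventually_le_const
    (show (0 : ℝ) < 1 / (8 * B) by positivity)
  filter_upwards [e1, e2] with j hj1 hj2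
  simp only [Function.comp_apply] at hj1 hj2
  have hW : 1 / (2 * B) ≤ μ.real (copySet T h₁ r s E j m (n j)) := by
    have h1 := h.measureReal_tower_le hT (j + m)
    have h2 := probReal_compl_eq_one_sub (μ := μ) (h.measurableSet_towerCore (j + m) 0)
    have h3 : (H (j + m) : ℝ) ≤ B * H j := by
      rw [hBdef]
      exact_mod_cast towerHeight_add_le hr hR hS j m
    have h4 : (H (j + m) : ℝ) * μ.real (E (j + m)) ≤ B * H j * μ.real (E (j + m)) := by gcongr
    rw [h.measureReal_copySet hT hr, div_le_iff₀ (by positivity)]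
    linarith
  have hV : μ.real (towerCore T h₁ r s E (j + k) (4 * H j))ᶜ ≤ 1 / (4 * B) := by
    have h1 := h.measureReal_towerCore_compl_le hT (j + k) (4 * H j)
    have h2 := h.towerHeight_mul_measureReal_add_le hT hr j k
    have h3 : (1 : ℝ) / 2 ^ k ≤ 1 / (64 * B) := one_div_le_one_div_of_le (by positivity) hk64
    have h4 : (1 : ℝ) / (64 * B) = 1 / (8 * B) / 8 := by field_simp; norm_num
    have h5 : (1 : ℝ) / (4 * B) = 2 * (1 / (8 * B)) := by field_simp; norm_num
    push_cast at h1
    linarith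
  have hsub : {z : X × X | z.1 ∈ copySet T h₁ r s E j m (n j)} ⊆
      {z | z.1 ∈ copySet T h₁ r s E j m (n j) ∧ z.2 ∈ towerCore T h₁ r s E (j + k) (4 * H j)} ∪
        {z | z.2 ∈ (towerCore T h₁ r s E (j + k) (4 * H j))ᶜ} := by
    intro z hz
    by_cases h' : z.2 ∈ towerCore T h₁ r s E (j + k) (4 * H j)
    · exact Or.inl ⟨hz, h'⟩
    · exact Or.inr h'
  have h1 := (measureReal_mono (μ := ν) hsub).trans (measureReal_union_le _ _)
  rw [hν.measureReal_fst (h.measurableSet_copySet j m _),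
    hν.measureReal_snd (h.measurableSet_towerCore _ _).compl] at h1
  have h2 : (1 : ℝ) / (2 * B) = 2 * (1 / (4 * B)) := by field_simp; norm_num
  linarith

/-- If the hierarchies of the two coordinates are almost surely translates of each other by `d`,
then the joining is carried by the graph of a power of `T`. -/
theorem eq_offDiagonal [IsProbabilityMeasure μ] (hν : IsSelfJoining μ T ν)
    (h : IsCuttingAndStacking μ T h₁ r s E C) (hT : MeasurePreserving T μ μ) {d : ℤ}
    (hd : ∀ᵐ z ∂ν, ∀ (i : ℕ) (n : ℤ), n ∈ visits T E z.1 i ↔ n + d ∈ visits T E z.2 i) :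
    ν = offDiagonal μ T d := by
  have := hν.isProbabilityMeasure
  -- unions of levels contain `x` if and only if they contain `T ^ d y`; approximate `A` by them
  have key : ∀ A, MeasurableSet A → ∀ᵐ z ∂ν, z.1 ∈ A ↔ power T d z.2 ∈ A := by
    intro A hA
    have hnull : ν.real {z | ¬ (z.1 ∈ A ↔ power T d z.2 ∈ A)} = 0 := by
      refine le_antisymm (le_of_forall_pos_le_add fun ε hε => ?_) measureReal_nonneg
      obtain ⟨j, F, -, hF⟩ := (h.eventually_exists_levels hA (ε := ε / 2) (by linarith)).exists
      set A' := {x | ∃ k ∈ F, -(k : ℤ) ∈ visits T E x j} with hA'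
      have hAm : MeasurableSet (A ∆ A') := hA.symmDiff (h.measurableSet_levels j F)
      have h1 : ν.real {z | z.1 ∈ A ∆ A'} = μ.real (A ∆ A') := hν.measureReal_fst hAm
      have h2 : ν.real {z | power T d z.2 ∈ A ∆ A'} = μ.real (A ∆ A') :=
        (hν.measureReal_snd (measurable_power T d hAm)).trans (measureReal_power_preimage hT d hAm)
      have h3 : ν.real {z | ¬ (z.1 ∈ A ↔ power T d z.2 ∈ A)} ≤
          ν.real ({z | z.1 ∈ A ∆ A'} ∪ {z | power T d z.2 ∈ A ∆ A'}) := by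
        refine ENNReal.toReal_mono (measure_ne_top _ _) (measure_mono_ae ?_)
        filter_upwards [hd] with z hz hzA
        have h4 : z.1 ∈ A' ↔ power T d z.2 ∈ A' := by
          simp only [hA', Set.mem_ofPred_eq, mem_visits_power]
          exact exists_congr fun k => and_congr_right fun _ => hz j _
        change ¬ (z.1 ∈ A ↔ power T d z.2 ∈ A) at hzA
        change z.1 ∈ A ∆ A' ∨ power T d z.2 ∈ A ∆ A'
        simp only [Set.mem_symmDiff]
        tauto
      have h4 := measureReal_union_le (μ := ν) {z | z.1 ∈ A ∆ A'} {z | power T d z.2 ∈ A ∆ A'}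
      linarith
    exact ae_iff.mpr ((measureReal_eq_zero_iff).mp hnull)
  have hprod : ∀ A B, MeasurableSet A → MeasurableSet B →
      offDiagonal μ T d (A ×ˢ B) = ν (A ×ˢ B) := by
    intro A B hA hB
    have hB' : MeasurableSet (power T (-d) ⁻¹' B) := measurable_power T _ hB
    have hm : Measurable fun x => (x, power T (-d) x) :=
      measurable_id.prodMk (measurable_power T (-d))
    rw [offDiagonal, Measure.map_apply hm (hA.prod hB)]
    have h1 : ν (A ×ˢ B) = ν (Prod.fst ⁻¹' (A ∩ power T (-d) ⁻¹' B)) := by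
      refine measure_congr ?_
      filter_upwards [key _ hB'] with z hz
      rw [Set.mem_preimage, Set.mem_preimage, ← power_add, neg_add_cancel, power_zero] at hz
      exact propext (and_congr_right fun _ => hz.symm)
    rw [h1, hν.measurePreserving_fst.measure_preimage (hA.inter hB').nullMeasurableSet]
    rfl
  have : IsFiniteMeasure (offDiagonal μ T d) := by unfold offDiagonal; infer_instance
  exact (Measure.ext_prod fun {A B} hA hB => (hprod A B hA hB).symm)

end IsSelfJoining

end Conclusion

end RankOne

theorem mainTheorem1 {X : Type*} [MeasurableSpace X] (μ : Measure X) [IsProbabilityMeasure μ]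
    (T : X ≃ᵐ X) (hT : MeasurePreserving T μ μ)
    (h₁ : ℕ) (r : ℕ → ℕ) (s : ℕ → ℕ → ℕ)
    (hrank : RankOne.IsRankOneConstruction μ T h₁ r s)
    (hbounded : RankOne.IsBoundedParameters r s)
    (hrigid : ¬ RankOne.IsRigid μ T)
    (herg : RankOne.IsTotallyErgodic μ T) :
    RankOne.HasMinimalSelfJoinings μ T := by
  open RankOne in
  intro ν hν hergν
  obtain ⟨E, C, h⟩ := hrank
  obtain ⟨hr, ⟨R, hR⟩, S, hS⟩ := hbounded
  have hR := fun j => (hR j).le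
  have hS := fun j i hi => (hS j i hi).le
  have := hν.isProbabilityMeasure
  by_cases hne : ν = μ.prod μ
  · exact Or.inl hne
  right
  obtain ⟨m, hm⟩ := h.exists_isUnequalGap hT hr hS hrigid
  choose! n hn using hm
  obtain ⟨k, hmk, c, hc, hcentral⟩ := hν.exists_le_measureReal_central h hT hr hR hS m n
  have hpos : 0 < 2 * (16 * (R * (S + 1)) ^ (m + 1)) := by
    have hR0 : 0 < R := by have := hr 0; have := hR 0; omega
    positivity
  -- the pairs with hierarchies that differ by the translation by `d`
  let Z : ℤ → Set (X × X) := fun d =>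
    {z | ∀ (i : ℕ) (n : ℤ), n ∈ visits T E z.1 i ↔ n + d ∈ visits T E z.2 i}
  have hZm : ∀ d, MeasurableSet (Z d) := fun d => by
    have hZ : Z d = ⋂ (i : ℕ) (n : ℤ),
        {z | n ∈ visits T E z.1 i ↔ n + d ∈ visits T E z.2 i} := by
      ext z
      simp [Z]
    rw [hZ]
    refine MeasurableSet.iInter fun i => MeasurableSet.iInter fun n => ?_
    exact (measurable_fst (h.measurableSet_mem_visits i n)).iff
      (measurable_snd (h.measurableSet_mem_visits i (n + d)))
  have hZinv : ∀ d, Prod.map T T ⁻¹' Z d = Z d := by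
    intro d
    ext z
    simp only [Z, Set.mem_preimage, Set.mem_ofPred_eq, Prod.map_fst, Prod.map_snd, ← power_one,
      mem_visits_power]
    refine forall_congr' fun i => ⟨fun hz n => ?_, fun hz n => ?_⟩
    · have := hz (n - 1)
      rwa [sub_add_cancel, show n - 1 + d + 1 = n + d by ring] at this
    · have := hz (n + 1)
      rwa [show n + 1 + d = n + d + 1 by ring] at this
  obtain ⟨d, hd⟩ : ∃ d, ∀ᵐ z ∂ν, z ∈ Z d := by
    by_contra hcon
    have hnull : ∀ᵐ z ∂ν, ∀ d, z ∉ Z d := ae_all_iff.mpr fun d =>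
      (hergν.toPreErgodic.ae_mem_or_ae_notMem (hZm d) (hZinv d)).resolve_left fun hd => hcon ⟨d, hd⟩
    refine not_ae_eventually_notMem (fun j => ?_) hc hcentral ?_
    · exact (measurable_fst (h.measurableSet_copySet j m (n j))).inter
        (measurable_snd (h.measurableSet_towerCore _ _))
    filter_upwards [hnull, hν.ae_eventually_noDrift hergν h hT hr herg hne _ _ (k * S) hpos,
      hν.measurePreserving_fst.quasiMeasurePreserving.ae (h.ae_eventually_mem_towerCore hT hr)]
      with z hz hdrift hcore
    by_contra hfreq
    have hfreq' : ∃ᶠ j in atTop, IsCentral h₁ r s (visits T E z.1) (visits T E z.2) m k j := by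
      refine ((not_eventually.mp hfreq).and_eventually (eventually_ge_atTop m)).mono ?_
      rintro j ⟨hj, hjm⟩
      obtain ⟨⟨a, ha, hax⟩, p, hp, hp1, hp2⟩ := not_not.mp hj
      refine ⟨⟨n j, hn j hjm, a, ha, hax⟩, (-p).toNat, by omega, by omega, ?_⟩
      rwa [show -(((-p).toNat : ℕ) : ℤ) = p by omega]
    obtain ⟨d, hd⟩ := exists_frequently_alignedAt (h.isHierarchy z.1) (h.isHierarchy z.2) hr hR hS
      hmk ((eventually_ge_atTop m).mono fun j hj => ⟨n j, hn j hj⟩)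
      (by simpa [towerCore] using hcore 0) hdrift hfreq'
    exact hz d (mem_iff_add_mem_of_frequently_alignedAt (h.isHierarchy z.1) (h.isHierarchy z.2) hr
      hcore hd)
  exact ⟨d, hν.eq_offDiagonal h hT hd⟩
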